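/- Let $A\in SL(2,\mathbb Z)$ have eigenvalues $0<\lambda^{-1}<1<\lambda$, and let $A$ also denote the induced automorphism of the torus $\mathbb T^2=\mathbb R^2/\mathbb Z^2$. Let $\pi\colon S\to\mathbb T^2$ be the real-analytic blow-up of $\mathbb T^2$ at the fixed point $0$ (a real-analytic surface), with exceptional fibre $C=\pi^{-1}(0)\cong\mathbb{RP}^1$, and let $f_A\colon S\to S$ be the lift of $A$: it is $A$ on $S\setminus C\cong\mathbb T^2\setminus\{0\}$ and the projective action of $A$ on $C$. Let $p_1\in C$ be the eigenline of $A$ for $\lambda$ and $p_2\in C$ the eigenline of $A$ for $\lambda^{-1}$. Two hyperbolic periodic points $p,q$ of a diffeomorphism are homoclinically related if the stable manifold of the orbit of $p$ has a transverse intersection point with the unstable manifold of the orbit of $q$, and vice versa. The intersection class of $p$ is the set of hyperbolic periodic points that are homoclinically related to $p$; the homoclinic class of $p$ is the closure of its intersection class. Then $f_A$ is a real-analytic diffeomorphism of $S$; the points $p_1$ and $p_2$ are hyperbolic fixed points of $f_A$, both of stable index $1$; the intersection class and the homoclinic class of $p_i$ are both equal to $\{p_i\}$ for $i=1,2$ (and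 so is the closure of the set of transverse intersection points of the stable and unstable manifolds of $p_i$). In particular the classes of $p_1$ and $p_2$ are disjoint, and $p_1$ and $p_2$ are not homoclinically related. Nevertheless there is a sequence of periodic orbits $\mathcal O_n\subset S\setminus C$ of $f_A$, all of them hyperbolic with Lyapunov exponents $-\log\lambda$ and $\log\lambda$, such that the invariant probability measures carried by the orbits $\mathcal O_n$ converge in the weak$*$ topology to $\tfrac12\delta_{p_1}+\tfrac12\delta_{p_2}$. (Thus, without any domination hypothesis, two hyperbolic ergodic measures of the same index may have a convex combination that is a limit of hyperbolic periodic measures with exponents bounded away from $0$, although the corresponding periodic points are not homoclinically related.) -/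

import Mathlib

open Set Filter Topology MeasureTheory Function
open scoped Manifold ContDiff ENNReal LinearAlgebra.Projectivization

noncomputable section

/-! ### Dynamics of a diffeomorphism of a boundaryless manifold

`M` is a manifold modelled on the finite-dimensional space `E`, and `f : Equiv.Perm M` is thought
of as a diffeomorphism of `M`. -/

namespace Dyn

variable {E : Type*} [NormedAddCommGroup E] [NormedSpace ℝ E] [FiniteDimensional ℝ E]
  {M : Type*} [TopologicalSpace M] [ChartedSpace E M]

/-- The derivative of `g : M → M` at `x`, read in the preferred charts at `x` and at `g x`, in which
the tangent spaces `T_x M` and `T_{g x} M` are identified with `E`. -/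
def tderiv (g : M → M) (x : M) : E →L[ℝ] E := mfderiv 𝓘(ℝ, E) 𝓘(ℝ, E) g x

/-- `p` is a hyperbolic periodic point of `f`: the derivative at `p` of the return map
`f^[n]`, `n` the minimal period, which is an endomorphism of `T_p M`, has no complex eigenvalue of
modulus one. -/
def IsHyperbolicPeriodicPt (f : Equiv.Perm M) (p : M) : Prop :=
  p ∈ periodicPts f ∧
    ∀ z : ℂ,
      Polynomial.aeval z
        (LinearMap.charpoly
          (tderiv (E := E) (f^[minimalPeriod f p]) p : E →ₗ[ℝ] E)) = 0 →
      ‖z‖ ≠ 1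

/-- The stable manifold of the periodic point `p`: the points whose forward orbit is asymptotic to
that of `p`. -/
def stableSet (f : Equiv.Perm M) (p : M) : Set M :=
  {y | Tendsto (fun k : ℕ => f^[minimalPeriod f p * k] y) atTop (𝓝 p)}

/-- The unstable manifold of the periodic point `p`. -/
def unstableSet (f : Equiv.Perm M) (p : M) : Set M := stableSet f.symm p

/-- The coordinate expression, in the preferred chart at `p` on the target side, of the derivative
at `x` of the `k`-th iterate of the return map of the periodic point `p`. -/
def returnDeriv (f : Equiv.Perm M) (p x : M) (k : ℕ) : TangentSpace 𝓘(ℝ, E) x →L[ℝ] E :=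
  mfderiv 𝓘(ℝ, E) 𝓘(ℝ, E)
    (fun y : M => extChartAt 𝓘(ℝ, E) p (f^[minimalPeriod f p * k] y)) x

/-- For `x` in the stable manifold of the hyperbolic periodic point `p`, the tangent space at `x`
of this stable manifold: the vectors `v` with `D(f ^ (n * k)) v → 0` as `k → ∞`, `n` the period of
`p`.  Since `f ^ (n * k) x → p`, these vectors are eventually read in the chart at `p`, so that no
choice of a metric is involved. -/
def stableSpace (f : Equiv.Perm M) (p x : M) : Submodule ℝ (TangentSpace 𝓘(ℝ, E) x) where
  carrier := {v | Tendsto (fun k : ℕ => returnDeriv (E := E) f p x k v) atTop (𝓝 0)}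
  zero_mem' := by simp
  add_mem' := by
    intro v w hv hw
    simpa using Tendsto.add hv hw
  smul_mem' := by
    intro c v hv
    simpa using Tendsto.const_smul hv c

/-- For `x` in the unstable manifold of the hyperbolic periodic point `p`, the tangent space at `x`
of this unstable manifold. -/
def unstableSpace (f : Equiv.Perm M) (p x : M) : Submodule ℝ (TangentSpace 𝓘(ℝ, E) x) :=
  stableSpace f.symm p x

/-- The stable index of a hyperbolic periodic point. -/
def stableIndex (f : Equiv.Perm M) (p : M) : ℕ :=
  Module.finrank ℝ (stableSpace (E := E) f p p)

/-- The set of transverse intersection points of the stable manifold of the orbit of `p` with the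
unstable manifold of the orbit of `q`. -/
def transverseIntersection (f : Equiv.Perm M) (p q : M) : Set M :=
  {x | ∃ i j : ℕ, x ∈ stableSet f (f^[i] p) ∧ x ∈ unstableSet f (f^[j] q) ∧
    stableSpace (E := E) f (f^[i] p) x ⊔ unstableSpace (E := E) f (f^[j] q) x = ⊤}

/-- Two hyperbolic periodic points are homoclinically related if the invariant manifolds of their
orbits meet cyclically and transversely. -/
def HomoclinicallyRelated (f : Equiv.Perm M) (p q : M) : Prop :=
  (transverseIntersection (E := E) f p q).Nonempty ∧
    (transverseIntersection (E := E) f q p).Nonempty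

/-- The intersection class of the hyperbolic periodic point `p`: its class for the homoclinic
relation on the set of hyperbolic periodic points. -/
def intersectionClass (f : Equiv.Perm M) (p : M) : Set M :=
  {q | IsHyperbolicPeriodicPt (E := E) f q ∧ HomoclinicallyRelated (E := E) f p q}

/-- The homoclinic class of the hyperbolic periodic point `p`: the closure of its intersection
class. -/
def homoclinicClass (f : Equiv.Perm M) (p : M) : Set M :=
  closure (intersectionClass (E := E) f p)

/-- The Lyapunov exponents at the periodic point `x` are the numbers `χ i`: the tangent space at
`x` splits into nonzero subspaces `V i` such that `(1/n) log ‖D(f ^ n) v‖ → χ i` as `|n| → ∞` for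
every nonzero `v` in `V i`.  As the orbit of `x` is finite, the limits do not depend on
the norms that are chosen on the tangent spaces along this orbit; here every tangent space has the
norm of `E`. -/
def HasLyapunovExponents {s : ℕ} (f : Equiv.Perm M) (x : M) (χ : Fin s → ℝ) : Prop :=
  StrictMono χ ∧ ∃ V : Fin s → Submodule ℝ (TangentSpace 𝓘(ℝ, E) x),
    DirectSum.IsInternal V ∧ ∀ i, V i ≠ ⊥ ∧ ∀ v ∈ V i, v ≠ 0 →
      Tendsto (fun n : ℤ =>
        (1 / (n : ℝ)) *
          Real.log ‖tderiv (E := E) (fun y : M => (f ^ n) y) x v‖)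
        cofinite (𝓝 (χ i))

/-- The invariant probability measure carried by the orbit of the periodic point `x`. -/
def orbitMeasure {X : Type*} [MeasurableSpace X] (f : X → X) (x : X) : Measure X :=
  (minimalPeriod f x : ℝ≥0∞)⁻¹ •
    ∑ k ∈ Finset.range (minimalPeriod f x), Measure.dirac (f^[k] x)

end Dyn

/-! ### Analytic surfaces from parametrizations -/

namespace Param

variable {E : Type*} [NormedAddCommGroup E] [NormedSpace ℝ E] {ι X : Type*}

/-- A family of injective parametrizations `P i : D i → X`, `D i ⊆ E` open, which cover `X` and
whose changes of coordinates are analytic. -/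
structure IsAnalyticFamily (P : ι → E → X) (D : ι → Set E) : Prop where
  isOpen : ∀ i, IsOpen (D i)
  injOn : ∀ i, InjOn (P i) (D i)
  cover : ∀ x, ∃ i, x ∈ P i '' D i
  change : ∀ i j, ∀ c ∈ D i, ∀ c' ∈ D j, P i c = P j c' →
    ∃ g : E → E, ContDiffAt ℝ ω g c ∧ g c = c' ∧ ∀ᶠ y in 𝓝 c, P j (g y) = P i y

variable {P : ι → E → X} {D : ι → Set E}

/-- The chart that is inverse to the parametrization `P i`. -/
def chart (h : IsAnalyticFamily P D) (i : ι) : PartialEquiv X E :=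
  ((h.injOn i).toPartialEquiv (P i) (D i)).symm

theorem change_spec (h : IsAnalyticFamily P D) (i j : ι) {c : E}
    (hc : c ∈ ((chart h i).symm.trans (chart h j)).source) :
    (∀ᶠ y in 𝓝 c, y ∈ ((chart h i).symm.trans (chart h j)).source) ∧
      ContDiffAt ℝ ω ((chart h i).symm.trans (chart h j)) c := by
  have hsrc : ∀ y, y ∈ ((chart h i).symm.trans (chart h j)).source ↔
      y ∈ D i ∧ P i y ∈ P j '' D j := by
    intro y
    simp [chart, PartialEquiv.trans_source, InjOn.toPartialEquiv, BijOn.toPartialEquiv]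
  have hval : ∀ y, ∀ z ∈ D j, P j z = P i y →
      ((chart h i).symm.trans (chart h j)) y = z := by
    intro y z hz hzy
    have h1 : ((chart h i).symm.trans (chart h j)) y = (chart h j) (P j z) := by
      rw [hzy]; rfl
    rw [h1]
    exact (chart h j).right_inv (x := z) hz
  obtain ⟨hci, c', hc', hcc⟩ := (hsrc c).1 hc
  obtain ⟨g, hg, hgc, hev⟩ := h.change i j c hci c' hc' hcc.symm
  have hgD : ∀ᶠ y in 𝓝 c, g y ∈ D j :=
    hg.continuousAt.eventually_mem (by rw [hgc]; exact (h.isOpen j).mem_nhds hc')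
  have hiD : ∀ᶠ y in 𝓝 c, y ∈ D i := (h.isOpen i).mem_nhds hci
  refine ⟨?_, ?_⟩
  · filter_upwards [hgD, hev, hiD] with y h1 h2 h3
    exact (hsrc y).2 ⟨h3, g y, h1, h2⟩
  · refine hg.congr_of_eventuallyEq ?_
    filter_upwards [hgD, hev] with y h1 h2
    exact hval y (g y) h1 h2

/-- The charted space structure with the charts `chart h i`. -/
def core (h : IsAnalyticFamily P D) : ChartedSpaceCore E X where
  atlas := range (chart h)
  chartAt x := chart h (h.cover x).choose
  mem_chart_source x := (h.cover x).choose_spec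
  chart_mem_atlas x := ⟨_, rfl⟩
  open_source := by
    rintro _ _ ⟨i, rfl⟩ ⟨j, rfl⟩
    exact isOpen_iff_mem_nhds.2 fun c hc => (change_spec h i j hc).1
  continuousOn_toFun := by
    rintro _ _ ⟨i, rfl⟩ ⟨j, rfl⟩ c hc
    exact (change_spec h i j hc).2.continuousAt.continuousWithinAt

theorem isManifold (h : IsAnalyticFamily P D) :
    @IsManifold ℝ _ E _ _ E _ 𝓘(ℝ, E) ω X (core h).toTopologicalSpace (core h).toChartedSpace := by
  let _ := (core h).toTopologicalSpace
  let _ := (core h).toChartedSpace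
  refine isManifold_of_contDiffOn _ _ _ ?_
  intro e e' he he'
  simp only [atlas, ChartedSpace.atlas, mem_iUnion, mem_singleton_iff] at he he'
  obtain ⟨_, ⟨i, rfl⟩, rfl⟩ := he
  obtain ⟨_, ⟨j, rfl⟩, rfl⟩ := he'
  intro c hc
  exact (change_spec h i j hc.1).2.contDiffWithinAt

end Param

/-! ### The blow-up of the two-torus at the origin -/

/-- The plane. -/
abbrev Plane : Type := Fin 2 → ℝ

/-- The torus `ℝ² / ℤ²`. -/
abbrev Torus : Type := UnitAddTorus (Fin 2)

/-- The projection of the plane onto the torus. -/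
def toTorus (v : Plane) : Torus := fun i => (v i : UnitAddCircle)

/-- The points of the blow-up of the torus at the origin: the nonzero points of the torus, and the
lines through the origin of the plane. -/
inductive Blowup : Type
  | regular (x : Torus) (hx : x ≠ 0) : Blowup
  | exceptional (l : ℙ ℝ Plane) : Blowup

namespace Blowup

/-- The canonical projection of the blow-up onto the torus. -/
def proj : Blowup → Torus
  | regular x _ => x
  | exceptional _ => 0

/-- The exceptional fibre. -/
def exceptionalFiber : Set Blowup := proj ⁻¹' {0}

open Classical in
/-- The point of the blow-up that lies over the class of `v` in the torus, and is the line
`l` if this class is zero. -/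
def mk (v : Plane) (l : ℙ ℝ Plane) : Blowup :=
  if h : toTorus v = 0 then exceptional l else regular (toTorus v) h

/-- `(1, t)` for `j = 0` and `(t, 1)` for `j = 1`. -/
def dir : Fin 2 → ℝ → Plane
  | 0, t => ![1, t]
  | 1, t => ![t, 1]

theorem dir_self (j : Fin 2) (t : ℝ) : dir j t j = 1 := by fin_cases j <;> simp [dir]

theorem dir_other (j : Fin 2) (t : ℝ) : dir j t (j + 1) = t := by fin_cases j <;> simp [dir]

theorem dir_ne_zero (j : Fin 2) (t : ℝ) : dir j t ≠ 0 := by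
  intro h
  have := congrFun h j
  simp [dir_self] at this

/-- The indices of the charts: the points of the plane off the lattice `ℤ²`, and the two
affine charts of the exceptional fibre. -/
abbrev Index : Type := {a : Plane // toTorus a ≠ 0} ⊕ Fin 2

/-- The parametrizations: the projection `v ↦ [v]` near `a`, and the usual blow-up
coordinates `(s, t) ↦ (s, s t)` and `(s, t) ↦ (s t, s)` near the exceptional fibre. -/
def param : Index → Plane → Blowup
  | .inl _, v => mk v (Projectivization.mk ℝ (dir 0 0) (dir_ne_zero 0 0))
  | .inr j, c => mk (c 0 • dir j (c 1)) (Projectivization.mk ℝ (dir j (c 1)) (dir_ne_zero j _))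

/-- The domains of the parametrizations; the first coordinate is allowed to vanish in the second
case, which yields the points of the exceptional fibre. -/
def dom : Index → Set Plane
  | .inl a => {v | (∀ i, |v i - a.1 i| < 1 / 2) ∧ toTorus v ≠ 0}
  | .inr j => {c | ∀ i, |(c 0 • dir j (c 1)) i| < 1 / 2}

theorem toTorus_add (v w : Plane) : toTorus (v + w) = toTorus v + toTorus w := by
  ext i; simp [toTorus]

theorem toTorus_sub (v w : Plane) : toTorus (v - w) = toTorus v - toTorus w := by
  ext i; simp [toTorus]

theorem toTorus_surjective (x : Torus) : ∃ v, toTorus v = x := by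
  have h : ∀ i, ∃ r : ℝ, (r : UnitAddCircle) = x i := fun i => QuotientAddGroup.mk_surjective (x i)
  choose v hv using h
  exact ⟨v, funext hv⟩

theorem continuous_toTorus : Continuous toTorus :=
  continuous_pi fun i => (AddCircle.continuous_mk' (1 : ℝ)).comp (continuous_apply i)

theorem toTorus_inj {v w : Plane} (h : toTorus v = toTorus w) (hvw : ∀ i, |w i - v i| < 1) :
    v = w := by
  ext i
  have h0 : ((w i - v i : ℝ) : UnitAddCircle) = 0 := by
    have := congrFun h i
    simp only [toTorus] at this
    rw [AddCircle.coe_sub, this, sub_self]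
  obtain ⟨n, hn⟩ := (AddCircle.coe_eq_zero_iff (1 : ℝ)).1 h0
  have h1 := hvw i
  simp only [zsmul_eq_mul, mul_one] at hn
  rw [← hn, ← Int.cast_abs] at h1
  have h2 : |n| < 1 := by exact_mod_cast h1
  have h3 : n = 0 := Int.abs_lt_one_iff.1 h2
  rw [h3] at hn
  push_cast at hn
  linarith

theorem toTorus_inj_of_half {a v w : Plane} (h : toTorus v = toTorus w)
    (hv : ∀ i, |v i - a i| < 1 / 2) (hw : ∀ i, |w i - a i| < 1 / 2) : v = w := by
  refine toTorus_inj h fun i => ?_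
  have h1 := abs_lt.1 (hv i)
  have h2 := abs_lt.1 (hw i)
  rw [abs_lt]
  constructor <;> linarith [h1.1, h1.2, h2.1, h2.2]

theorem toTorus_inj_box {v w : Plane} (h : toTorus v = toTorus w)
    (hv : ∀ i, |v i| < 1 / 2) (hw : ∀ i, |w i| < 1 / 2) : v = w :=
  toTorus_inj_of_half (a := 0) h (by simpa using hv) (by simpa using hw)

theorem toTorus_zero : toTorus 0 = 0 := by
  ext i; simp [toTorus]

theorem toTorus_box_eq_zero {j : Fin 2} {c : Plane} (hc : c ∈ dom (.inr j)) :
    toTorus (c 0 • dir j (c 1)) = 0 ↔ c 0 = 0 := by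
  constructor
  · intro h
    have h1 := toTorus_inj_box (h.trans toTorus_zero.symm) hc (by simp)
    have := congrFun h1 j
    simpa [dir_self] using this
  · intro h
    rw [h, zero_smul, toTorus_zero]

theorem mk_eq_mk {v w : Plane} {l m : ℙ ℝ Plane} :
    mk v l = mk w m ↔ toTorus v = toTorus w ∧ (toTorus v = 0 → l = m) := by
  unfold mk
  by_cases hv : toTorus v = 0 <;> by_cases hw : toTorus w = 0
  · simp [hv, hw]
  · simp [hv, hw, eq_comm]
  · simp [hv, hw]
  · simp [hv, hw]

theorem fin_two_cases (j k : Fin 2) : k = j ∨ k = j + 1 := by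
  fin_cases j <;> fin_cases k <;> simp

theorem fin_two_add (j : Fin 2) : j + 1 + 1 = j := by
  fin_cases j <;> simp

theorem plane_ext {v w : Plane} (j : Fin 2) (h : v j = w j) (h' : v (j + 1) = w (j + 1)) :
    v = w := by
  ext k
  rcases fin_two_cases j k with rfl | rfl
  · exact h
  · exact h'

theorem contDiff_dir (j : Fin 2) : ContDiff ℝ ω (fun c : Plane => c 0 • dir j (c 1)) := by
  rw [contDiff_pi]
  intro k
  rcases fin_two_cases j k with rfl | rfl
  · simp only [Pi.smul_apply, dir_self, smul_eq_mul, mul_one]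
    fun_prop
  · simp only [Pi.smul_apply, dir_other, smul_eq_mul]
    fun_prop

theorem isOpen_dom (i : Index) : IsOpen (dom i) := by
  rcases i with a | j
  · refine IsOpen.inter (s := {v : Plane | ∀ i, |v i - a.1 i| < 1 / 2}) ?_ ?_
    · rw [ofPred_forall]
      exact isOpen_iInter_of_finite fun i => isOpen_lt (by fun_prop) continuous_const
    · exact isOpen_compl_singleton.preimage continuous_toTorus
  · simp only [dom]
    rw [ofPred_forall]
    exact isOpen_iInter_of_finite fun i => isOpen_lt
      ((continuous_apply i).comp (contDiff_dir j).continuous).abs continuous_const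

theorem injOn_param (i : Index) : InjOn (param i) (dom i) := by
  rcases i with a | j
  · intro v hv w hw h
    exact toTorus_inj_of_half (mk_eq_mk.1 h).1 hv.1 hw.1
  · intro c hc c' hc' h
    obtain ⟨h1, h2⟩ := mk_eq_mk.1 h
    have h3 := toTorus_inj_box h1 hc hc'
    have h4 : c 0 = c' 0 := by simpa [dir_self] using congrFun h3 j
    have h5 : c 1 = c' 1 := by
      by_cases h0 : c 0 = 0
      · have h6 := h2 ((toTorus_box_eq_zero hc).2 h0)
        obtain ⟨r, hr⟩ := (Projectivization.mk_eq_mk_iff' ℝ _ _ _ _).1 h6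
        have h7 : r = 1 := by simpa [dir_self] using congrFun hr j
        rw [h7, one_smul] at hr
        simpa [dir_other] using (congrFun hr (j + 1)).symm
      · have h6 := congrFun h3 (j + 1)
        simp only [Pi.smul_apply, dir_other, smul_eq_mul, ← h4] at h6
        exact mul_left_cancel₀ h0 h6
    exact plane_ext 0 h4 h5

theorem cover_param (x : Blowup) : ∃ i, x ∈ param i '' dom i := by
  rcases x with ⟨x, hx⟩ | l
  · obtain ⟨v, rfl⟩ := toTorus_surjective x
    refine ⟨.inl ⟨v, hx⟩, v, ⟨by simp, hx⟩, ?_⟩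
    simp [param, mk, hx]
  · induction l using Projectivization.ind with
    | h v hv =>
      have hj : ∃ j : Fin 2, v j ≠ 0 := by
        by_contra! h
        exact hv (funext h)
      obtain ⟨j, hj⟩ := hj
      refine ⟨.inr j, ![0, v (j + 1) / v j], by simp [dom], ?_⟩
      simp only [param, Matrix.cons_val_zero, zero_smul, mk, toTorus_zero, dite_true]
      congr 1
      rw [Projectivization.mk_eq_mk_iff']
      refine ⟨(v j)⁻¹, plane_ext j ?_ ?_⟩
      · simp [dir_self, hj]
      · simp [dir_other, div_eq_inv_mul]

theorem change_param (i j : Index) (c : Plane) (hc : c ∈ dom i) (c' : Plane) (hc' : c' ∈ dom j)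
    (h : param i c = param j c') :
    ∃ g : Plane → Plane, ContDiffAt ℝ ω g c ∧ g c = c' ∧
      ∀ᶠ y in 𝓝 c, param j (g y) = param i y := by
  rcases i with a | i <;> rcases j with b | j
  · obtain ⟨h1, h2⟩ := mk_eq_mk.1 h
    refine ⟨fun y => y + (c' - c), by fun_prop, by simp, .of_forall fun y => ?_⟩
    refine mk_eq_mk.2 ⟨?_, fun _ => rfl⟩
    rw [toTorus_add, toTorus_sub, h1, sub_self, add_zero]
  · obtain ⟨h1, h2⟩ := mk_eq_mk.1 h
    set d := c' 0 • dir j (c' 1) - c with hd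
    have hd0 : toTorus d = 0 := by rw [hd, toTorus_sub, h1, sub_self]
    have hcd : c + d = c' 0 • dir j (c' 1) := by rw [hd]; abel
    have hc0 : c' 0 ≠ 0 := fun h0 => hc.2 (h1.trans ((toTorus_box_eq_zero hc').2 h0))
    have hcj : c j + d j = c' 0 := by
      have := congrFun hcd j
      simpa [dir_self] using this
    have hcj' : c (j + 1) + d (j + 1) = c' 0 * c' 1 := by
      have := congrFun hcd (j + 1)
      simpa [dir_other] using this
    refine ⟨fun y => ![y j + d j, (y (j + 1) + d (j + 1)) / (y j + d j)], ?_, ?_, ?_⟩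
    · rw [contDiffAt_pi]
      intro k
      fin_cases k
      · simp only [Fin.zero_eta, Matrix.cons_val_zero]
        fun_prop
      · simp only [Fin.mk_one, Matrix.cons_val_one]
        refine ContDiffAt.div (by fun_prop) (by fun_prop) ?_
        rw [hcj]; exact hc0
    · refine plane_ext 0 ?_ ?_
      · simpa using hcj
      · simp only [zero_add, Matrix.cons_val_one]
        rw [hcj, hcj']
        exact mul_div_cancel_left₀ _ hc0
    · have e1 : ∀ᶠ y : Plane in 𝓝 c, y j + d j ≠ 0 := by
        refine ContinuousAt.eventually_ne
          (((continuous_apply j).add continuous_const).continuousAt) ?_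
        rw [hcj]; exact hc0
      filter_upwards [e1, (isOpen_dom (.inl a)).mem_nhds hc] with y hy hya
      have key : (y j + d j) • dir j ((y (j + 1) + d (j + 1)) / (y j + d j)) = y + d := by
        refine plane_ext j ?_ ?_
        · simp [dir_self]
        · simp only [Pi.smul_apply, dir_other, smul_eq_mul, Pi.add_apply]
          field_simp
      have key2 : toTorus (y + d) = toTorus y := by rw [toTorus_add, hd0, add_zero]
      refine mk_eq_mk.2 ⟨?_, fun h0 => ?_⟩
      · simp only [Matrix.cons_val_zero, Matrix.cons_val_one]
        rw [key, key2]
      · simp only [Matrix.cons_val_zero, Matrix.cons_val_one] at h0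
        rw [key, key2] at h0
        exact absurd h0 hya.2
  · obtain ⟨h1, h2⟩ := mk_eq_mk.1 h
    have hg : ContDiff ℝ ω
        (fun y : Plane => y 0 • dir i (y 1) + (c' - c 0 • dir i (c 1))) :=
      (contDiff_dir i).add contDiff_const
    have hgc : (fun y : Plane => y 0 • dir i (y 1) + (c' - c 0 • dir i (c 1))) c = c' := by
      simp
    refine ⟨_, hg.contDiffAt, hgc, ?_⟩
    have e1 := hg.continuous.continuousAt.eventually_mem (x := c)
      ((isOpen_dom (.inl b)).mem_nhds (by rw [add_sub_cancel]; exact hc'))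
    filter_upwards [e1] with y hy
    refine mk_eq_mk.2 ⟨?_, fun h0 => absurd h0 hy.2⟩
    rw [toTorus_add, toTorus_sub, h1, sub_self, add_zero]
  · by_cases hij : j = i
    · subst hij
      exact ⟨id, contDiffAt_id, injOn_param _ hc hc' h, .of_forall fun _ => rfl⟩
    · have hij' : j = i + 1 := (fin_two_cases i j).resolve_left hij
      subst hij'
      obtain ⟨h1, h2⟩ := mk_eq_mk.1 h
      have h3 := toTorus_inj_box h1 hc hc'
      have h4 : c 0 = c' 0 * c' 1 := by
        have := congrFun h3 i
        have e := dir_other (i + 1) (c' 1)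
        rw [fin_two_add] at e
        simpa [dir_self, e] using this
      have h5 : c 0 * c 1 = c' 0 := by
        have := congrFun h3 (i + 1)
        simpa [dir_self, dir_other] using this
      have h6 : c 1 * c' 1 = 1 := by
        by_cases h0 : c 0 = 0
        · have h6 := h2 ((toTorus_box_eq_zero hc).2 h0)
          obtain ⟨r, hr⟩ := (Projectivization.mk_eq_mk_iff' ℝ _ _ _ _).1 h6
          have e := dir_other (i + 1) (c' 1)
          rw [fin_two_add] at e
          have h7 : r * c' 1 = 1 := by simpa [dir_self, e] using congrFun hr i
          have h8 : r = c 1 := by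
            simpa [dir_self, dir_other] using congrFun hr (i + 1)
          rw [← h8]; exact h7
        · have : c 0 * (c 1 * c' 1) = c 0 * 1 := by
            rw [← mul_assoc, h5, mul_one, ← h4]
          exact mul_left_cancel₀ h0 this
      have hc1 : c 1 ≠ 0 := left_ne_zero_of_mul_eq_one h6
      refine ⟨fun y => ![y 0 * y 1, (y 1)⁻¹], ?_, ?_, ?_⟩
      · rw [contDiffAt_pi]
        intro k
        fin_cases k
        · simp only [Fin.zero_eta, Matrix.cons_val_zero]
          fun_prop
        · simp only [Fin.mk_one, Matrix.cons_val_one]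
          exact ContDiffAt.inv (by fun_prop) hc1
      · refine plane_ext 0 ?_ ?_
        · simpa using h5
        · simp only [zero_add, Matrix.cons_val_one]
          exact inv_eq_of_mul_eq_one_right h6
      · have e1 : ∀ᶠ y : Plane in 𝓝 c, y 1 ≠ 0 :=
          ContinuousAt.eventually_ne (continuous_apply (1 : Fin 2)).continuousAt hc1
        filter_upwards [e1] with y hy
        have key : dir (i + 1) (y 1)⁻¹ = (y 1)⁻¹ • dir i (y 1) := by
          refine plane_ext (i + 1) ?_ ?_
          · simp [dir_self, dir_other, hy]
          · rw [dir_other, fin_two_add]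
            simp [dir_self]
        refine mk_eq_mk.2 ⟨?_, fun _ => ?_⟩
        · simp only [Matrix.cons_val_zero, Matrix.cons_val_one]
          rw [key, smul_smul, mul_assoc, mul_inv_cancel₀ hy, mul_one]
        · rw [Projectivization.mk_eq_mk_iff']
          exact ⟨(y 1)⁻¹, by simpa using key.symm⟩

theorem isAnalyticFamily : Param.IsAnalyticFamily param dom :=
  ⟨isOpen_dom, injOn_param, cover_param, change_param⟩

instance : TopologicalSpace Blowup := (Param.core isAnalyticFamily).toTopologicalSpace

instance : ChartedSpace Plane Blowup := (Param.core isAnalyticFamily).toChartedSpace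

/-- The blow-up is a real-analytic surface. -/
instance : IsManifold 𝓘(ℝ, Plane) ω Blowup := Param.isManifold isAnalyticFamily

instance : MeasurableSpace Blowup := borel Blowup

instance : BorelSpace Blowup := ⟨rfl⟩

end Blowup

/-! ### The lift of a linear automorphism of the torus -/

/-- The linear automorphism of the plane given by `A`. -/
def planeMap (A : Matrix.SpecialLinearGroup (Fin 2) ℤ) : Plane →ₗ[ℝ] Plane :=
  Matrix.toLin' (A.1.map (Int.cast : ℤ → ℝ))

/-- The automorphism of the torus induced by `A`. -/
def torusEnd (A : Matrix.SpecialLinearGroup (Fin 2) ℤ) (x : Torus) : Torus :=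
  fun i => ∑ j, A.1 i j • x j

theorem planeMap_mul (A B : Matrix.SpecialLinearGroup (Fin 2) ℤ) (v : Plane) :
    planeMap (A * B) v = planeMap A (planeMap B v) := by
  have : (A * B).1.map (Int.cast : ℤ → ℝ) = A.1.map (Int.cast : ℤ → ℝ) * B.1.map Int.cast := by
    ext i j
    simp [Matrix.mul_apply]
  simp only [planeMap, this, Matrix.toLin'_mul, LinearMap.comp_apply]

theorem planeMap_one (v : Plane) : planeMap 1 v = v := by
  have : (1 : Matrix.SpecialLinearGroup (Fin 2) ℤ).1.map (Int.cast : ℤ → ℝ) = 1 := by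
    ext i j
    simp [Matrix.one_apply, apply_ite]
  simp only [planeMap, this, Matrix.toLin'_one, LinearMap.id_apply]

theorem planeMap_injective (A : Matrix.SpecialLinearGroup (Fin 2) ℤ) : Injective (planeMap A) := by
  refine LeftInverse.injective (g := planeMap A⁻¹) fun v => ?_
  rw [← planeMap_mul, inv_mul_cancel, planeMap_one]

theorem torusEnd_toTorus (A : Matrix.SpecialLinearGroup (Fin 2) ℤ) (v : Plane) :
    torusEnd A (toTorus v) = toTorus (planeMap A v) := by
  ext i
  simp [torusEnd, toTorus, planeMap, Matrix.mulVec, dotProduct, Fin.sum_univ_two,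
    ← zsmul_eq_mul]

theorem torusEnd_mul (A B : Matrix.SpecialLinearGroup (Fin 2) ℤ) (x : Torus) :
    torusEnd (A * B) x = torusEnd A (torusEnd B x) := by
  obtain ⟨v, rfl⟩ := Blowup.toTorus_surjective x
  simp only [torusEnd_toTorus, planeMap_mul]

theorem torusEnd_one (x : Torus) : torusEnd 1 x = x := by
  obtain ⟨v, rfl⟩ := Blowup.toTorus_surjective x
  simp only [torusEnd_toTorus, planeMap_one]

theorem torusEnd_zero (A : Matrix.SpecialLinearGroup (Fin 2) ℤ) : torusEnd A 0 = 0 := by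
  ext i; simp [torusEnd]

theorem torusEnd_ne_zero (A : Matrix.SpecialLinearGroup (Fin 2) ℤ) {x : Torus} (hx : x ≠ 0) :
    torusEnd A x ≠ 0 := by
  intro h
  apply hx
  rw [← torusEnd_one x, ← inv_mul_cancel A, torusEnd_mul, h, torusEnd_zero]

namespace Blowup

/-- The lift of the torus automorphism `A` to the blow-up: it is `A` off the exceptional fibre, and
the projective action of `A` on the exceptional fibre. -/
def lift (A : Matrix.SpecialLinearGroup (Fin 2) ℤ) : Blowup → Blowup
  | regular x hx => regular (torusEnd A x) (torusEnd_ne_zero A hx)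
  | exceptional l => exceptional (l.map (planeMap A) (planeMap_injective A))

theorem lift_mul (A B : Matrix.SpecialLinearGroup (Fin 2) ℤ) (x : Blowup) :
    lift (A * B) x = lift A (lift B x) := by
  rcases x with ⟨x, hx⟩ | l
  · simp [lift, torusEnd_mul]
  · induction l using Projectivization.ind with
    | h v hv => simp [lift, Projectivization.map_mk, planeMap_mul]

theorem lift_one (x : Blowup) : lift 1 x = x := by
  rcases x with ⟨x, hx⟩ | l
  · simp [lift, torusEnd_one]
  · induction l using Projectivization.ind with
    | h v hv => simp [lift, Projectivization.map_mk, planeMap_one]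

theorem proj_lift (A : Matrix.SpecialLinearGroup (Fin 2) ℤ) (x : Blowup) :
    proj (lift A x) = torusEnd A (proj x) := by
  rcases x with ⟨x, hx⟩ | l
  · rfl
  · exact (torusEnd_zero A).symm

/-- The blown-up automorphism `f_A`, as a permutation of the blow-up. -/
def perm (A : Matrix.SpecialLinearGroup (Fin 2) ℤ) : Equiv.Perm Blowup where
  toFun := lift A
  invFun := lift A⁻¹
  left_inv x := by rw [← lift_mul, inv_mul_cancel, lift_one]
  right_inv x := by rw [← lift_mul, mul_inv_cancel, lift_one]

/-- The measure `½ δ_p + ½ δ_q`. -/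
def halfDirac (p q : Blowup) : ProbabilityMeasure Blowup :=
  ⟨(2⁻¹ : ℝ≥0∞) • Measure.dirac p + (2⁻¹ : ℝ≥0∞) • Measure.dirac q,
    ⟨by simp [ENNReal.inv_two_add_inv_two]⟩⟩

end Blowup

end

/-!
Write `f` for the lift of `A`.  For a basis `(b, d)` of the plane, the map
`polar b d : (s, t) ↦ s (b + t d)`, with value the line of `b + t d` for `s = 0`, is analytic along
`s = 0`, with invertible derivative there, and if `A b = α b`, `A d = β d`, then `f` acts in these
coordinates as the diagonal map `(α s, (β / α) t)` (`perm_polar`).  With `(b, d) = (u, w)` this is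
`(lam, lam⁻²)` at `p₁`, and with `(b, d) = (w, u)` it is `(lam⁻¹, lam²)` at `p₂`; so both points are
saddles.  Replacing `A` by `A⁻¹` exchanges `u` and `w`, hence `p₁` and `p₂`, and turns stable objects
into unstable ones (`Saddle.symm`); half of the statements follow from the other half in this way.

*Classes.*  A point off the exceptional fibre whose orbit converges to the fibre projects to the
stable set of `0` in the torus, so that its orbit ends on the eigenline of `w` and converges to `p₂`.
Hence the stable set of `p₁` is the fibre without `p₂` (`Saddle.exists_slope_of_mem_stableSet`), and
by symmetry the unstable set of `p₂` is the fibre without `p₁`.  The backward orbit of a point of the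
stable set of `p₁` is therefore fixed or converges to `p₂`, so that only `p₁` and `p₂` could be
related to `p₁` (`Saddle.eq_or_eq_of_mem_stableSet`).  But the stable space of `p₁` and the unstable
space of `p₂` are both tangent to the fibre at every common point, so that there is no transverse
intersection (`Saddle.transverseIntersection_u_w`).  The tangent spaces of the stable manifolds are
computed by reading the dynamics in a linearizing parametrization (`Dyn.mem_stableSpace_iff`).

*Periodic orbits.*  Write the integral vector `(1, 0)` as `a u - b w`; neither `a` nor `b` vanishes,
as `A` has integral entries.  The point `y = (a u + b w) / (lam ^ M - lam ^ (-M))` satisfies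
`A ^ M y - A ^ (-M) y = a u - b w`, so that it projects to a periodic point of period `2 M`.  For
`0 ≤ k < M` the point `A ^ k y` has the eigencoordinates
`(a lam ^ k / (lam ^ M - lam ^ (-M)), (b / a) lam ^ (-2 k))`, which are small unless `k` or `M - k` is
bounded; thus the forward half of the orbit spends most of its time near `p₁`, and by symmetry the
backward half spends most of its time near `p₂` (`Saddle.tendsto_average_half_orbit`).  Off the fibre
the derivative of `f` is conjugate to `A`, which gives the exponents.
-/

noncomputable section

namespace Blowup

/-! ### The charts of the blow-up -/

/-- The chart inverse to the parametrization `param i`. -/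
def atlasChart (i : Index) : OpenPartialHomeomorph Blowup Plane :=
  (Param.core isAnalyticFamily).openPartialHomeomorph (Param.chart isAnalyticFamily i) ⟨i, rfl⟩

theorem atlasChart_mem_atlas (i : Index) : atlasChart i ∈ atlas Plane Blowup := by
  simp only [atlas, ChartedSpace.atlas, mem_iUnion, mem_singleton_iff]
  exact ⟨_, ⟨i, rfl⟩, rfl⟩

theorem atlasChart_mem_maximalAtlas (i : Index) :
    atlasChart i ∈ IsManifold.maximalAtlas 𝓘(ℝ, Plane) ω Blowup :=
  IsManifold.subset_maximalAtlas (atlasChart_mem_atlas i)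

theorem atlasChart_param {i : Index} {c : Plane} (hc : c ∈ dom i) :
    atlasChart i (param i c) = c :=
  (atlasChart i).right_inv hc

theorem param_mem_source {i : Index} {c : Plane} (hc : c ∈ dom i) :
    param i c ∈ (atlasChart i).source :=
  (atlasChart i).map_target hc

theorem contMDiffAt_param {i : Index} {c : Plane} (hc : c ∈ dom i) :
    ContMDiffAt 𝓘(ℝ, Plane) 𝓘(ℝ, Plane) ω (param i) c :=
  (contMDiffOn_symm_of_mem_maximalAtlas (atlasChart_mem_maximalAtlas i)).contMDiffAt
    ((isOpen_dom i).mem_nhds hc)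

theorem contMDiffAt_atlasChart {i : Index} {c : Plane} (hc : c ∈ dom i) :
    ContMDiffAt 𝓘(ℝ, Plane) 𝓘(ℝ, Plane) ω (atlasChart i) (param i c) :=
  contMDiffAt_of_mem_maximalAtlas (atlasChart_mem_maximalAtlas i) (param_mem_source hc)

theorem eventually_param_atlasChart {i : Index} {c : Plane} (hc : c ∈ dom i) :
    ∀ᶠ x in 𝓝 (param i c), param i (atlasChart i x) = x :=
  (atlasChart i).eventually_left_inverse (param_mem_source hc)

theorem contMDiffAt_of_comp_param {F : Blowup → Blowup} {i : Index} {c : Plane} (hc : c ∈ dom i)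
    (h : ContMDiffAt 𝓘(ℝ, Plane) 𝓘(ℝ, Plane) ω (F ∘ param i) c) :
    ContMDiffAt 𝓘(ℝ, Plane) 𝓘(ℝ, Plane) ω F (param i c) := by
  have h1 : ContMDiffAt 𝓘(ℝ, Plane) 𝓘(ℝ, Plane) ω ((F ∘ param i) ∘ atlasChart i) (param i c) := by
    refine ContMDiffAt.comp _ ?_ (contMDiffAt_atlasChart hc)
    rwa [atlasChart_param hc]
  refine h1.congr_of_eventuallyEq ?_
  filter_upwards [eventually_param_atlasChart hc] with x hx
  simp [hx]

theorem continuousAt_of_comp_param {Y : Type*} [TopologicalSpace Y] {F : Blowup → Y} {i : Index}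
    {c : Plane} (hc : c ∈ dom i) (h : ContinuousAt (F ∘ param i) c) :
    ContinuousAt F (param i c) := by
  have h1 : ContinuousAt ((F ∘ param i) ∘ atlasChart i) (param i c) := by
    refine ContinuousAt.comp ?_ (contMDiffAt_atlasChart hc).continuousAt
    rwa [atlasChart_param hc]
  refine h1.congr ?_
  filter_upwards [eventually_param_atlasChart hc] with x hx
  simp [hx]

theorem proj_mk (v : Plane) (l : ℙ ℝ Plane) : proj (mk v l) = toTorus v := by
  unfold mk
  split_ifs with h
  · exact h.symm
  · rfl

theorem continuous_proj : Continuous proj := by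
  refine continuous_iff_continuousAt.2 fun x => ?_
  obtain ⟨i, c, hc, rfl⟩ := cover_param x
  refine continuousAt_of_comp_param hc ?_
  rcases i with a | j
  · have : proj ∘ param (.inl a) = toTorus := funext fun v => proj_mk _ _
    rw [this]
    exact continuous_toTorus.continuousAt
  · have : proj ∘ param (.inr j) = fun c : Plane => toTorus (c 0 • dir j (c 1)) :=
      funext fun v => proj_mk _ _
    rw [this]
    exact (continuous_toTorus.comp (contDiff_dir j).continuous).continuousAt

theorem isOpen_image_param {i : Index} {s : Set Plane} (hs : IsOpen s) (h : s ⊆ dom i) :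
    IsOpen (param i '' s) :=
  (atlasChart i).symm.isOpen_image_of_subset_source hs h

/-- In the overlap of the two affine charts along the exceptional fibre, the slopes are inverse
to each other. -/
theorem slope_mul_slope {j : Fin 2} {c c' : Plane} (hc : c ∈ dom (.inr j))
    (hc' : c' ∈ dom (.inr (j + 1))) (h : param (.inr j) c = param (.inr (j + 1)) c') :
    c 1 * c' 1 = 1 := by
  obtain ⟨h1, h2⟩ := mk_eq_mk.1 h
  have h3 := toTorus_inj_box h1 hc hc'
  have e := dir_other (j + 1) (c' 1)
  rw [fin_two_add] at e
  have h4 : c 0 = c' 0 * c' 1 := by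
    have := congrFun h3 j
    simpa [dir_self, e] using this
  have h5 : c 0 * c 1 = c' 0 := by
    have := congrFun h3 (j + 1)
    simpa [dir_self, dir_other] using this
  by_cases h0 : c 0 = 0
  · have h6 := h2 ((toTorus_box_eq_zero hc).2 h0)
    obtain ⟨r, hr⟩ := (Projectivization.mk_eq_mk_iff' ℝ _ _ _ _).1 h6
    have h7 : r * c' 1 = 1 := by simpa [dir_self, e] using congrFun hr j
    have h8 : r = c 1 := by
      simpa [dir_self, dir_other] using congrFun hr (j + 1)
    rw [← h8]; exact h7
  · have : c 0 * (c 1 * c' 1) = c 0 * 1 := by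
      rw [← mul_assoc, h5, mul_one, ← h4]
    exact mul_left_cancel₀ h0 this

/-- Points with different projections are separated by `proj`, and points in the domain of one chart
by this chart; the remaining case is that of a line in one affine chart and of the coordinate line
which this chart misses. -/
instance : T2Space Blowup := by
  refine ⟨fun x y hxy => ?_⟩
  by_cases hp : proj x = proj y
  swap
  · obtain ⟨U, V, hU, hV, hx, hy, hd⟩ := t2_separation hp
    exact ⟨_, _, hU.preimage continuous_proj, hV.preimage continuous_proj, hx, hy,
      hd.preimage proj⟩
  obtain ⟨i, c, hc, rfl⟩ := cover_param x
  by_cases hy : y ∈ (atlasChart i).source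
  · -- both points lie in the domain of one chart
    have hne : atlasChart i (param i c) ≠ atlasChart i y := fun h =>
      hxy ((atlasChart i).injOn (param_mem_source hc) hy h)
    obtain ⟨U, V, hU, hV, hx, hy', hd⟩ := t2_separation hne
    refine ⟨_, _, (atlasChart i).isOpen_inter_preimage hU, (atlasChart i).isOpen_inter_preimage hV,
      ⟨param_mem_source hc, hx⟩, ⟨hy, hy'⟩, ?_⟩
    exact (hd.preimage (atlasChart i)).mono inter_subset_right inter_subset_right
  obtain ⟨k, c', hc', rfl⟩ := cover_param y
  rcases i with a | i
  · -- a regular point is determined by its projection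
    exfalso
    have hk : param k c' = param (.inl a) c := by
      rcases k with b | k
      · simp only [param, proj_mk] at hp
        exact mk_eq_mk.2 ⟨hp.symm, fun _ => rfl⟩
      · refine mk_eq_mk.2 ⟨?_, fun h0 => ?_⟩
        · simpa only [param, proj_mk] using hp.symm
        · simp only [param, proj_mk] at hp
          exact absurd (hp.trans h0) hc.2
    exact hxy hk.symm
  rcases k with b | k
  · exfalso
    simp only [param, proj_mk] at hp
    exact hxy (mk_eq_mk.2 ⟨hp, fun h0 => absurd (hp.symm.trans h0) hc'.2⟩)
  have hik : k = i + 1 := (fin_two_cases i k).resolve_left fun h => by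
    subst h; exact hy (param_mem_source hc')
  subst hik
  -- the points have slopes `c 1` and `c' 1` in the two affine charts, with `c' 1 = 0`
  have hdom : ∀ j : Fin 2, ∀ t : ℝ, (![0, t] : Plane) ∈ dom (.inr j) := by
    intro j t k; simp
  have hc0 : c 0 = 0 ∧ c' 0 = 0 := by
    simp only [param, proj_mk] at hp
    by_cases h0 : c 0 = 0
    · refine ⟨h0, (toTorus_box_eq_zero hc').1 ?_⟩
      rw [← hp]; exact (toTorus_box_eq_zero hc).2 h0
    · have h1 : toTorus (c 0 • dir i (c 1)) ≠ 0 := fun h => h0 ((toTorus_box_eq_zero hc).1 h)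
      exact absurd (mk_eq_mk.2 ⟨hp, fun h => absurd h h1⟩) hxy
  have hc1 : c' 1 = 0 := by
    by_contra h1
    have h2 : param (.inr (i + 1)) c' = param (.inr i) ![0, (c' 1)⁻¹] := by
      refine mk_eq_mk.2 ⟨by simp [hc0.2], fun _ => ?_⟩
      rw [Projectivization.mk_eq_mk_iff']
      refine ⟨c' 1, plane_ext i ?_ ?_⟩
      · have e := dir_other (i + 1) (c' 1)
        rw [fin_two_add] at e
        simp [dir_self, e]
      · simp [dir_self, dir_other, h1]
    rw [h2] at hy
    exact hy (param_mem_source (hdom _ _))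
  have hR : 0 < |c 1| + 1 := by positivity
  have hopen : ∀ r : ℝ, IsOpen {y : Plane | |y 1| < r} := fun r =>
    isOpen_lt (continuous_apply (1 : Fin 2)).abs continuous_const
  refine ⟨param (.inr i) '' (dom (.inr i) ∩ {y | |y 1| < |c 1| + 1}),
    param (.inr (i + 1)) '' (dom (.inr (i + 1)) ∩ {y | |y 1| < (|c 1| + 1)⁻¹}),
    isOpen_image_param ((isOpen_dom _).inter (hopen _)) inter_subset_left,
    isOpen_image_param ((isOpen_dom _).inter (hopen _)) inter_subset_left,
    ⟨c, ⟨hc, by simp⟩, rfl⟩, ⟨c', ⟨hc', by simpa [hc1] using hR⟩, rfl⟩, ?_⟩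
  rw [Set.disjoint_left]
  rintro _ ⟨z, ⟨hz, hz1⟩, rfl⟩ ⟨z', ⟨hz', hz1'⟩, hzz⟩
  have h1 := slope_mul_slope hz hz' hzz.symm
  have h2 : |z 1| * |z' 1| = 1 := by rw [← abs_mul, h1, abs_one]
  simp only [mem_ofPred_eq] at hz1 hz1'
  have h3 : |z 1| * |z' 1| < (|c 1| + 1) * (|c 1| + 1)⁻¹ :=
    mul_lt_mul'' hz1 hz1' (abs_nonneg _) (abs_nonneg _)
  rw [mul_inv_cancel₀ hR.ne', h2] at h3
  exact lt_irrefl _ h3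

/-! ### Linear blow-up coordinates -/

/-- The line spanned by `v`; a default value is used for `v = 0`. -/
def line (v : Plane) : ℙ ℝ Plane :=
  if h : v ≠ 0 then Projectivization.mk ℝ v h else Projectivization.mk ℝ (dir 0 0) (dir_ne_zero 0 0)

theorem line_of_ne_zero {v : Plane} (h : v ≠ 0) : line v = Projectivization.mk ℝ v h := by
  simp [line, h]

theorem line_smul {v : Plane} {r : ℝ} (hr : r ≠ 0) : line (r • v) = line v := by
  by_cases hv : v = 0
  · simp [hv]
  · rw [line_of_ne_zero hv, line_of_ne_zero (smul_ne_zero hr hv), Projectivization.mk_eq_mk_iff']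
    exact ⟨r, rfl⟩

/-- The determinant of two vectors of the plane. -/
def cross (b d : Plane) : ℝ := b 0 * d 1 - b 1 * d 0

/-- The blow-up coordinates `(s, t) ↦ s (b + t d)` that are attached to the basis `(b, d)` of the
plane: for `s = 0` the value is the line spanned by `b + t d`. -/
def polar (b d : Plane) (c : Plane) : Blowup := mk (c 0 • (b + c 1 • d)) (line (b + c 1 • d))

theorem add_smul_ne_zero {b d : Plane} (h : cross b d ≠ 0) (t : ℝ) : b + t • d ≠ 0 := by
  intro h0
  apply h
  have e0 := congrFun h0 0
  have e1 := congrFun h0 1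
  simp only [Pi.add_apply, Pi.smul_apply, smul_eq_mul, Pi.zero_apply] at e0 e1
  unfold cross
  linear_combination d 1 * e0 - d 0 * e1

theorem dir_eq_add (j : Fin 2) (t : ℝ) : dir j t = dir j 0 + t • dir (j + 1) 0 := by
  fin_cases j <;> ext k <;> fin_cases k <;> simp [dir]

theorem param_inr_eq_polar (j : Fin 2) : param (.inr j) = polar (dir j 0) (dir (j + 1) 0) := by
  funext c
  simp only [param, polar, ← dir_eq_add, line_of_ne_zero (dir_ne_zero j (c 1))]

theorem cross_dir (j : Fin 2) : cross (dir j 0) (dir (j + 1) 0) ≠ 0 := by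
  fin_cases j <;> simp [dir, cross]

theorem polar_exceptional (b d : Plane) {c : Plane} (h : c 0 = 0) :
    polar b d c = exceptional (line (b + c 1 • d)) := by
  simp [polar, mk, h, toTorus_zero]

/-- The change of linear blow-up coordinates that is given by a matrix with rows `(p, q)` and
`(r, s)`. -/
def mobius (p q r s : ℝ) (y : Plane) : Plane :=
  ![y 0 * (p + q * y 1), (r + s * y 1) / (p + q * y 1)]

theorem contDiffAt_mobius {p q r s : ℝ} {c : Plane} (h : p + q * c 1 ≠ 0) :
    ContDiffAt ℝ ω (mobius p q r s) c := by
  rw [contDiffAt_pi]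
  intro k
  fin_cases k
  · simp only [mobius, Fin.zero_eta, Matrix.cons_val_zero]
    fun_prop
  · simp only [mobius, Fin.mk_one, Matrix.cons_val_one]
    exact ContDiffAt.div (by fun_prop) (by fun_prop) h

theorem mobius_mobius {p q r s : ℝ} (hd : p * s - q * r ≠ 0) {y : Plane} (h : p + q * y 1 ≠ 0) :
    mobius s (-q) (-r) p (mobius p q r s y) = ![(p * s - q * r) * y 0, y 1] := by
  have key : s + -q * ((r + s * y 1) / (p + q * y 1)) = (p * s - q * r) / (p + q * y 1) := by
    field_simp; ring
  have key2 : -r + p * ((r + s * y 1) / (p + q * y 1)) = (p * s - q * r) * y 1 / (p + q * y 1) := by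
    rw [eq_div_iff h]
    linear_combination p * div_mul_cancel₀ (r + s * y 1) h
  simp only [mobius, Matrix.cons_val_zero, Matrix.cons_val_one, key, key2]
  ext k
  fin_cases k
  · simp; field_simp
  · simp; field_simp

theorem exists_polar_eq_param {b d : Plane} (h : cross b d ≠ 0) (t : ℝ) :
    ∃ j : Fin 2, b j + d j * t ≠ 0 ∧ b j * d (j + 1) - d j * b (j + 1) ≠ 0 ∧
      ∀ y : Plane, b j + d j * y 1 ≠ 0 →
        polar b d y = param (.inr j) (mobius (b j) (d j) (b (j + 1)) (d (j + 1)) y) := by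
  have hj : ∃ j : Fin 2, b j + d j * t ≠ 0 := by
    by_contra! h0
    exact add_smul_ne_zero h t (funext fun k => by simpa [mul_comm] using h0 k)
  obtain ⟨j, hj⟩ := hj
  refine ⟨j, hj, ?_, fun y hy => ?_⟩
  · unfold cross at h
    fin_cases j
    · simpa [mul_comm] using h
    · intro h1; apply h; simp at h1; linarith
  · have key : b + y 1 • d =
        (b j + d j * y 1) • dir j ((b (j + 1) + d (j + 1) * y 1) / (b j + d j * y 1)) := by
      refine plane_ext j ?_ ?_
      · simp [dir_self, mul_comm]
      · simp only [Pi.add_apply, Pi.smul_apply, smul_eq_mul, dir_other]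
        rw [← mul_div_assoc, mul_div_cancel_left₀ _ hy, mul_comm (y 1)]
    simp only [polar, param, mobius, Matrix.cons_val_zero, Matrix.cons_val_one, key,
      line_smul hy, line_of_ne_zero (dir_ne_zero j _), smul_smul]

theorem mobius_mem_dom {p q r s : ℝ} {c : Plane} (h : c 0 = 0) (j : Fin 2) :
    mobius p q r s c ∈ dom (.inr j) := by
  intro k; simp [mobius, h]

theorem eventually_ne_zero_slope {p q : ℝ} {c : Plane} (h : p + q * c 1 ≠ 0) :
    ∀ᶠ y : Plane in 𝓝 c, p + q * y 1 ≠ 0 :=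
  ContinuousAt.eventually_ne
    (continuous_const.add (continuous_const.mul (continuous_apply 1))).continuousAt h

theorem contMDiffAt_polar {b d : Plane} (h : cross b d ≠ 0) {c : Plane} (hc : c 0 = 0) :
    ContMDiffAt 𝓘(ℝ, Plane) 𝓘(ℝ, Plane) ω (polar b d) c := by
  obtain ⟨j, h1, -, h2⟩ := exists_polar_eq_param h (c 1)
  have h3 := (contMDiffAt_param (mobius_mem_dom hc j)).comp c
    (contDiffAt_mobius (r := b (j + 1)) (s := d (j + 1)) h1).contMDiffAt
  refine h3.congr_of_eventuallyEq ?_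
  filter_upwards [eventually_ne_zero_slope h1] with y hy
  exact h2 y hy

end Blowup

theorem mfderiv_injective_of_leftInverse {E M : Type*} [NormedAddCommGroup E] [NormedSpace ℝ E]
    [TopologicalSpace M] [ChartedSpace E M] {P : E → M} {G : M → E} {c : E}
    (hP : MDifferentiableAt 𝓘(ℝ, E) 𝓘(ℝ, E) P c)
    (hG : MDifferentiableAt 𝓘(ℝ, E) 𝓘(ℝ, E) G (P c)) (h : ∀ᶠ y in 𝓝 c, G (P y) = y) :
    Injective (mfderiv 𝓘(ℝ, E) 𝓘(ℝ, E) P c) := by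
  have h1 : mfderiv 𝓘(ℝ, E) 𝓘(ℝ, E) (G ∘ P) c = ContinuousLinearMap.id ℝ E := by
    have h2 : G ∘ P =ᶠ[𝓝 c] id := h
    rw [h2.mfderiv_eq]
    exact mfderiv_id
  rw [mfderiv_comp c hG hP] at h1
  refine LeftInverse.injective (g := mfderiv 𝓘(ℝ, E) 𝓘(ℝ, E) G (P c)) fun v => ?_
  exact congrArg (fun T : E →L[ℝ] E => T v) h1

namespace Blowup

theorem mfderiv_param_injective {i : Index} {c : Plane} (hc : c ∈ dom i) :
    Injective (mfderiv 𝓘(ℝ, Plane) 𝓘(ℝ, Plane) (param i) c) := by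
  refine mfderiv_injective_of_leftInverse (G := atlasChart i)
    ((contMDiffAt_param hc).mdifferentiableAt (by simp))
    ((contMDiffAt_atlasChart hc).mdifferentiableAt (by simp)) ?_
  filter_upwards [(isOpen_dom i).mem_nhds hc] with y hy
  exact atlasChart_param hy

theorem mfderiv_polar_injective {b d : Plane} (h : cross b d ≠ 0) {c : Plane} (hc : c 0 = 0) :
    Injective (mfderiv 𝓘(ℝ, Plane) 𝓘(ℝ, Plane) (polar b d) c) := by
  obtain ⟨j, h1, hD, h2⟩ := exists_polar_eq_param h (c 1)
  set p := b j
  set q := d j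
  set r := b (j + 1)
  set s := d (j + 1)
  have hm : mobius p q r s c ∈ dom (.inr j) := mobius_mem_dom hc j
  have hG : ContDiffAt ℝ ω (fun y : Plane => ![(p * s - q * r)⁻¹ * mobius s (-q) (-r) p y 0,
      mobius s (-q) (-r) p y 1]) (mobius p q r s c) := by
    have h3 : ContDiffAt ℝ ω (mobius s (-q) (-r) p) (mobius p q r s c) := by
      refine contDiffAt_mobius ?_
      have : s + -q * ((r + s * c 1) / (p + q * c 1)) = (p * s - q * r) / (p + q * c 1) := by
        field_simp; ring
      change s + -q * ((r + s * c 1) / (p + q * c 1)) ≠ 0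
      rw [this]
      exact div_ne_zero hD h1
    have h4 := contDiffAt_pi.1 h3
    rw [contDiffAt_pi]
    intro k
    fin_cases k
    · exact contDiffAt_const.mul (h4 0)
    · exact h4 1
  refine mfderiv_injective_of_leftInverse
    (G := (fun y : Plane => ![(p * s - q * r)⁻¹ * mobius s (-q) (-r) p y 0,
      mobius s (-q) (-r) p y 1]) ∘ atlasChart (.inr j))
    ((contMDiffAt_polar h hc).mdifferentiableAt (by simp)) ?_ ?_
  · refine MDifferentiableAt.comp _ (I' := 𝓘(ℝ, Plane)) ?_ ?_
    · rw [h2 c h1, atlasChart_param hm]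
      exact hG.contMDiffAt.mdifferentiableAt (by simp)
    · rw [h2 c h1]
      exact (contMDiffAt_atlasChart hm).mdifferentiableAt (by simp)
  · have hev : ∀ᶠ y in 𝓝 c, mobius p q r s y ∈ dom (.inr j) :=
      (contDiffAt_mobius (r := r) (s := s) h1).continuousAt.eventually_mem
        ((isOpen_dom _).mem_nhds hm)
    filter_upwards [eventually_ne_zero_slope h1, hev] with y hy hy2
    rw [h2 y hy]
    simp only [comp_apply, atlasChart_param hy2, mobius_mobius hD hy]
    ext k
    fin_cases k
    · simp [hD]
    · simp

/-! ### Analyticity of the lift -/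

theorem toTorus_planeMap (A : Matrix.SpecialLinearGroup (Fin 2) ℤ) {v : Plane} :
    toTorus (planeMap A v) = 0 ↔ toTorus v = 0 := by
  rw [← torusEnd_toTorus]
  refine ⟨fun h => ?_, fun h => by rw [h, torusEnd_zero]⟩
  by_contra h0
  exact torusEnd_ne_zero A h0 h

theorem lift_mk (A : Matrix.SpecialLinearGroup (Fin 2) ℤ) (v : Plane) (l : ℙ ℝ Plane) :
    lift A (mk v l) = mk (planeMap A v) (l.map (planeMap A) (planeMap_injective A)) := by
  by_cases hv : toTorus v = 0
  · simp [mk, hv, (toTorus_planeMap A).2 hv, lift]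
  · simp [mk, hv, mt (toTorus_planeMap A).1 hv, lift, torusEnd_toTorus]

theorem map_line (A : Matrix.SpecialLinearGroup (Fin 2) ℤ) {v : Plane} (hv : v ≠ 0) :
    (line v).map (planeMap A) (planeMap_injective A) = line (planeMap A v) := by
  have h : planeMap A v ≠ 0 := by
    rw [Ne, map_eq_zero_iff _ (planeMap_injective A)]; exact hv
  rw [line_of_ne_zero hv, line_of_ne_zero h, Projectivization.map_mk]

theorem lift_polar (A : Matrix.SpecialLinearGroup (Fin 2) ℤ) {b d : Plane} (h : cross b d ≠ 0)
    (c : Plane) : lift A (polar b d c) = polar (planeMap A b) (planeMap A d) c := by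
  simp only [polar, lift_mk, map_line A (add_smul_ne_zero h (c 1)), map_add, map_smul]

theorem planeMap_apply_zero (A : Matrix.SpecialLinearGroup (Fin 2) ℤ) (v : Plane) :
    planeMap A v 0 = A.1 0 0 * v 0 + A.1 0 1 * v 1 := by
  simp [planeMap, Matrix.mulVec, dotProduct, Fin.sum_univ_two]

theorem planeMap_apply_one (A : Matrix.SpecialLinearGroup (Fin 2) ℤ) (v : Plane) :
    planeMap A v 1 = A.1 1 0 * v 0 + A.1 1 1 * v 1 := by
  simp [planeMap, Matrix.mulVec, dotProduct, Fin.sum_univ_two]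

theorem cross_planeMap (A : Matrix.SpecialLinearGroup (Fin 2) ℤ) (b d : Plane) :
    cross (planeMap A b) (planeMap A d) = cross b d := by
  have h : A.1 0 0 * A.1 1 1 - A.1 0 1 * A.1 1 0 = 1 := by
    rw [← Matrix.det_fin_two]; exact A.2
  have h' : (A.1 0 0 : ℝ) * A.1 1 1 - A.1 0 1 * A.1 1 0 = 1 := by exact_mod_cast h
  simp only [cross, planeMap_apply_zero, planeMap_apply_one]
  linear_combination (b 0 * d 1 - b 1 * d 0) * h'

theorem contMDiff_lift (A : Matrix.SpecialLinearGroup (Fin 2) ℤ) :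
    ContMDiff 𝓘(ℝ, Plane) 𝓘(ℝ, Plane) ω (lift A) := by
  intro x
  have hreg : ∀ (a : {a : Plane // toTorus a ≠ 0}) (c : Plane), c ∈ dom (.inl a) →
      ContMDiffAt 𝓘(ℝ, Plane) 𝓘(ℝ, Plane) ω (lift A) (param (.inl a) c) := by
    intro a c hc
    refine contMDiffAt_of_comp_param hc ?_
    have hA : toTorus (planeMap A c) ≠ 0 := mt (toTorus_planeMap A).1 hc.2
    have hL : ContDiffAt ℝ ω (planeMap A) c :=
      (LinearMap.toContinuousLinearMap (planeMap A)).contDiff.contDiffAt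
    have h1 := (contMDiffAt_param (i := .inl ⟨_, hA⟩) (c := planeMap A c)
      ⟨by simp, hA⟩).comp c hL.contMDiffAt
    refine h1.congr_of_eventuallyEq ?_
    filter_upwards [(isOpen_dom (.inl a)).mem_nhds hc] with v hv
    simp only [comp_apply, param, lift_mk]
    exact mk_eq_mk.2 ⟨rfl, fun h => absurd ((toTorus_planeMap A).1 h) hv.2⟩
  obtain ⟨i, c, hc, rfl⟩ := cover_param x
  rcases i with a | j
  · exact hreg a c hc
  · by_cases h0 : c 0 = 0
    · refine contMDiffAt_of_comp_param hc ?_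
      have h1 : lift A ∘ param (.inr j) =
          polar (planeMap A (dir j 0)) (planeMap A (dir (j + 1) 0)) := by
        funext y
        rw [param_inr_eq_polar, comp_apply, lift_polar A (cross_dir j)]
      rw [h1]
      exact contMDiffAt_polar (by rw [cross_planeMap]; exact cross_dir j) h0
    · have h1 : toTorus (c 0 • dir j (c 1)) ≠ 0 := mt (toTorus_box_eq_zero hc).1 h0
      have h2 : param (.inr j) c = param (.inl ⟨_, h1⟩) (c 0 • dir j (c 1)) :=
        mk_eq_mk.2 ⟨rfl, fun h => absurd h h1⟩
      rw [h2]
      exact hreg _ _ ⟨by simp, h1⟩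

end Blowup

/-! ### Hyperbolicity and invariant spaces read in linearizing parametrizations -/

/-- If `T k → T` with `T` injective, then `T k (v k) → 0` exactly when `v k → 0`. -/
theorem tendsto_clm_apply_zero_iff {E F : Type*} [NormedAddCommGroup E] [NormedSpace ℝ E]
    [FiniteDimensional ℝ E] [NormedAddCommGroup F] [NormedSpace ℝ F] {T : ℕ → E →L[ℝ] F}
    {S : E →L[ℝ] F} (hT : Tendsto T atTop (𝓝 S)) (hS : Injective S) (v : ℕ → E) :
    Tendsto (fun k => T k (v k)) atTop (𝓝 0) ↔ Tendsto v atTop (𝓝 0) := by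
  constructor
  · intro h
    obtain ⟨K, hK0, hK⟩ := (S : E →ₗ[ℝ] F).exists_antilipschitzWith (LinearMap.ker_eq_bot.2 hS)
    have hK' : ∀ x, ‖x‖ ≤ K * ‖S x‖ := fun x => by simpa using hK.le_mul_norm_sub x 0
    have hK0' : (0 : ℝ) < K := hK0
    have hd : ∀ᶠ k in atTop, ‖T k - S‖ < (2 * K : ℝ)⁻¹ := by
      have := (tendsto_iff_norm_sub_tendsto_zero.1 hT)
      exact this.eventually (gt_mem_nhds (by positivity))
    refine squeeze_zero_norm' (a := fun k => 2 * K * ‖T k (v k)‖) ?_ ?_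
    · filter_upwards [hd] with k hk
      have h1 : ‖S (v k)‖ ≤ ‖T k (v k)‖ + ‖T k - S‖ * ‖v k‖ := by
        have h2 : S (v k) = T k (v k) - (T k - S) (v k) := by simp
        rw [h2]
        exact (norm_sub_le _ _).trans (by gcongr; exact (T k - S).le_opNorm _)
      have h3 : ‖T k - S‖ * ‖v k‖ ≤ (2 * K : ℝ)⁻¹ * ‖v k‖ := by gcongr
      have h4 := hK' (v k)
      have h5 : (K : ℝ) * ‖S (v k)‖ ≤ K * (‖T k (v k)‖ + (2 * K : ℝ)⁻¹ * ‖v k‖) := by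
        gcongr; linarith
      have h6 : (K : ℝ) * ((2 * K : ℝ)⁻¹ * ‖v k‖) = ‖v k‖ / 2 := by field_simp
      rw [mul_add, h6] at h5
      linarith
    · simpa using (h.norm).const_mul (2 * K : ℝ)
  · intro h
    have h1 := (isBoundedBilinearMap_apply (𝕜 := ℝ) (E := E) (F := F)).continuous.tendsto (S, 0)
    simpa using! h1.comp (hT.prodMk_nhds h)

/-- The roots of the characteristic polynomial of an endomorphism with an eigenbasis are the
eigenvalues of this basis. -/
theorem exists_eq_of_aeval_charpoly_eq_zero {E ι : Type*} [AddCommGroup E] [Module ℝ E]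
    [Module.Free ℝ E] [Module.Finite ℝ E] [Fintype ι] [DecidableEq ι]
    (b : Module.Basis ι ℝ E) (μ : ι → ℝ) {T : E →ₗ[ℝ] E} (h : ∀ i, T (b i) = μ i • b i) {z : ℂ}
    (hz : Polynomial.aeval z T.charpoly = 0) : ∃ i, z = μ i := by
  have hm : LinearMap.toMatrix b b T = Matrix.diagonal μ := by
    ext i j
    rw [LinearMap.toMatrix_apply, h, Matrix.diagonal_apply]
    by_cases hij : i = j
    · subst hij; simp
    · simp [hij]
  rw [← LinearMap.charpoly_toMatrix T b, hm, Matrix.charpoly_diagonal] at hz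
  simp only [map_prod, map_sub, Polynomial.aeval_X, Polynomial.aeval_C, Finset.prod_eq_zero_iff,
    Finset.mem_univ, true_and] at hz
  obtain ⟨i, hi⟩ := hz
  exact ⟨i, sub_eq_zero.1 hi⟩

namespace Dyn

variable {E : Type*} [NormedAddCommGroup E] [NormedSpace ℝ E]
  {M : Type*} [TopologicalSpace M] [ChartedSpace E M]

/-- The chain rule for a semiconjugacy `g ∘ Ψ = Ψ ∘ L` to a linear map. -/
theorem tderiv_apply_of_semiconj {g : M → M} {Ψ : E → M} {L : E →L[ℝ] E}
    {c : E} (h : ∀ᶠ y in 𝓝 c, g (Ψ y) = Ψ (L y)) (hg : MDifferentiableAt 𝓘(ℝ, E) 𝓘(ℝ, E) g (Ψ c))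
    (hΨ : MDifferentiableAt 𝓘(ℝ, E) 𝓘(ℝ, E) Ψ c)
    (hΨ' : MDifferentiableAt 𝓘(ℝ, E) 𝓘(ℝ, E) Ψ (L c)) (v : E) :
    tderiv (E := E) g (Ψ c) (mfderiv 𝓘(ℝ, E) 𝓘(ℝ, E) Ψ c v) =
      mfderiv 𝓘(ℝ, E) 𝓘(ℝ, E) Ψ (L c) (L v) := by
  have h1 := hg.hasMFDerivAt.comp c hΨ.hasMFDerivAt
  have h2 := hΨ'.hasMFDerivAt.comp c L.hasFDerivAt.hasMFDerivAt
  have h3 : g ∘ Ψ =ᶠ[𝓝 c] Ψ ∘ L := h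
  exact congrArg (fun T : E →L[ℝ] E => T v)
    (hasMFDerivAt_unique h1 (h2.congr_of_eventuallyEq h3))

theorem isHyperbolicPeriodicPt_of_eigenbasis [FiniteDimensional ℝ E] {ι : Type*} [Fintype ι]
    [DecidableEq ι]
    {f : Equiv.Perm M} {p : M} (hp : p ∈ periodicPts f) (b : Module.Basis ι ℝ E) (μ : ι → ℝ)
    (h : ∀ i, tderiv (E := E) (f^[minimalPeriod f p]) p (b i) = μ i • b i)
    (hμ : ∀ i, |μ i| ≠ 1) : IsHyperbolicPeriodicPt (E := E) f p := by
  refine ⟨hp, fun z hz => ?_⟩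
  obtain ⟨i, rfl⟩ := exists_eq_of_aeval_charpoly_eq_zero b μ h hz
  simpa using hμ i

theorem iterate_semiconj {X : Type*} {g : X → X} {Ψ : E → X} {L : E →L[ℝ] E}
    (h : ∀ y, g (Ψ y) = Ψ (L y)) (k : ℕ) (y : E) : g^[k] (Ψ y) = Ψ ((L ^ k) y) := by
  induction k generalizing y with
  | zero => simp
  | succ k ih => rw [iterate_succ_apply, h, ih, pow_succ, mul_apply_eq_comp]

/-- If `Ψ` conjugates `f` to the linear map `L`, and `L ^ k c → 0`, then the stable space at `Ψ c`
of the fixed point `Ψ 0` is the image of the stable space of `L`. -/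
theorem mem_stableSpace_iff [FiniteDimensional ℝ E] [IsManifold 𝓘(ℝ, E) 1 M]
    {f : Equiv.Perm M} {Ψ : E → M}
    {L : E →L[ℝ] E} (hf : MDifferentiable 𝓘(ℝ, E) 𝓘(ℝ, E) f) (h : ∀ y, f (Ψ y) = Ψ (L y))
    (h0 : ContMDiffAt 𝓘(ℝ, E) 𝓘(ℝ, E) 1 Ψ 0) (hinj : Injective (mfderiv 𝓘(ℝ, E) 𝓘(ℝ, E) Ψ 0))
    {c : E} (hΨ : MDifferentiableAt 𝓘(ℝ, E) 𝓘(ℝ, E) Ψ c)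
    (hc : Tendsto (fun k : ℕ => (L ^ k) c) atTop (𝓝 0)) (v : E) :
    (mfderiv 𝓘(ℝ, E) 𝓘(ℝ, E) Ψ c v) ∈ stableSpace (E := E) f (Ψ 0) (Ψ c) ↔
      Tendsto (fun k : ℕ => (L ^ k) v) atTop (𝓝 0) := by
  have hm : minimalPeriod f (Ψ 0) = 1 := by
    rw [minimalPeriod_eq_one_iff_isFixedPt]
    exact (h 0).trans (by simp)
  set φ := extChartAt 𝓘(ℝ, E) (Ψ 0) with hφ
  -- the expression of `Ψ` in the chart at the fixed point
  set H : E → E := φ ∘ Ψ with hH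
  have hH0 : ContDiffAt ℝ 1 H 0 := by
    rw [← contMDiffAt_iff_contDiffAt]
    exact (contMDiffAt_extChartAt (n := 1)).comp 0 h0
  have hfd : Tendsto (fun k : ℕ => fderiv ℝ H ((L ^ k) c)) atTop (𝓝 (fderiv ℝ H 0)) :=
    (hH0.continuousAt_fderiv (by simp)).tendsto.comp hc
  have hΨ0 : MDifferentiableAt 𝓘(ℝ, E) 𝓘(ℝ, E) Ψ 0 := h0.mdifferentiableAt (by simp)
  have hHinj : Injective (fderiv ℝ H 0) := by
    rw [← mfderiv_eq_fderiv, hH, mfderiv_comp 0 (mdifferentiableAt_extChartAt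
      (ChartedSpace.mem_chart_source (Ψ 0))) hΨ0]
    have h1 := (isInvertible_mfderiv_extChartAt (I := 𝓘(ℝ, E))
      (mem_extChartAt_source (I := 𝓘(ℝ, E)) (Ψ 0))).injective
    exact h1.comp hinj
  have hHd : ∀ᶠ y in 𝓝 (0 : E), DifferentiableAt ℝ H y := by
    filter_upwards [hH0.eventually (by simp)] with y hy
    exact hy.differentiableAt (by simp)
  have hsrc : ∀ᶠ y in 𝓝 (0 : E), Ψ y ∈ (chartAt E (Ψ 0)).source :=
    h0.continuousAt.eventually_mem ((chartAt E (Ψ 0)).open_source.mem_nhds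
      (ChartedSpace.mem_chart_source (Ψ 0)))
  have hfk : ∀ k, MDifferentiable 𝓘(ℝ, E) 𝓘(ℝ, E) (f^[k]) := by
    intro k
    induction k with
    | zero => exact mdifferentiable_id
    | succ k ih => rw [iterate_succ]; exact ih.comp hf
  have key : ∀ᶠ k : ℕ in atTop, returnDeriv (E := E) f (Ψ 0) (Ψ c) k
      (mfderiv 𝓘(ℝ, E) 𝓘(ℝ, E) Ψ c v) = fderiv ℝ H ((L ^ k) c) ((L ^ k) v) := by
    filter_upwards [hc.eventually hHd, hc.eventually hsrc] with k hk1 hk2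
    have hd1 : MDifferentiableAt 𝓘(ℝ, E) 𝓘(ℝ, E) (fun y : M => φ (f^[1 * k] y)) (Ψ c) := by
      refine MDifferentiableAt.comp (I' := 𝓘(ℝ, E)) (Ψ c) (g := φ) (f := f^[1 * k]) ?_ (hfk _ _)
      refine mdifferentiableAt_extChartAt ?_
      rw [one_mul, iterate_semiconj h]
      exact hk2
    have h1 := mfderiv_comp_apply c hd1 hΨ v
    have h2 : (fun y : M => φ (f^[1 * k] y)) ∘ Ψ = H ∘ (L ^ k) := by
      funext y
      simp only [comp_apply, one_mul, iterate_semiconj h, hH]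
    rw [h2, mfderiv_eq_fderiv, fderiv_comp c hk1 (L ^ k).differentiableAt] at h1
    rw [(L ^ k).fderiv] at h1
    unfold returnDeriv
    rw [hm]
    exact h1.symm
  rw [← tendsto_clm_apply_zero_iff hfd hHinj]
  exact tendsto_congr' key

/-- Lyapunov exponents from a basis whose vectors are multiplied by `exp (n χ i)` by the derivative
of `f ^ n`, up to vectors which take finitely many nonzero values. -/
theorem hasLyapunovExponents_of_basis {s : ℕ} {f : Equiv.Perm M} {x : M} {χ : Fin s → ℝ}
    (hχ : StrictMono χ) (b : Module.Basis (Fin s) ℝ E) (w : Fin s → ℤ → E)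
    (hw : ∀ i n, w i n ≠ 0) (hfin : ∀ i, (range (w i)).Finite)
    (h : ∀ i (n : ℤ), tderiv (E := E) (fun y : M => (f ^ n) y) x (b i) =
      Real.exp (n * χ i) • w i n) :
    HasLyapunovExponents (E := E) f x χ := by
  refine ⟨hχ, fun i => Submodule.span ℝ {(b i : E)}, ?_, fun i => ⟨?_, ?_⟩⟩
  · refine DirectSum.isInternal_submodule_of_iSupIndep_of_iSup_eq_top
      (b.linearIndependent.iSupIndep_span_singleton) ?_
    have := b.span_eq
    rwa [Submodule.span_range_eq_iSup] at this
  · exact fun h0 => b.ne_zero i (Submodule.span_singleton_eq_bot.1 h0)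
  · intro v hv hv0
    obtain ⟨r, rfl⟩ := Submodule.mem_span_singleton.1 hv
    have hr : r ≠ 0 := by
      rintro rfl
      exact hv0 (zero_smul _ _)
    have hnorm : ∀ n : ℤ, Real.log ‖tderiv (E := E) (fun y : M => (f ^ n) y) x (r • b i)‖ =
        n * χ i + Real.log (|r| * ‖w i n‖) := by
      intro n
      have h1 : tderiv (E := E) (fun y : M => (f ^ n) y) x (r • b i) =
          r • Real.exp (n * χ i) • w i n := by
        rw [map_smul, h]
      rw [h1, norm_smul, norm_smul, Real.norm_eq_abs, Real.norm_eq_abs, Real.abs_exp,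
        mul_left_comm, Real.log_mul (Real.exp_pos _).ne', Real.log_exp]
      exact mul_ne_zero (abs_ne_zero.2 hr) (norm_ne_zero_iff.2 (hw i n))
    have hbdd : ∃ C, ∀ n, |Real.log (|r| * ‖w i n‖)| ≤ C := by
      have h1 : ((fun y : E => |Real.log (|r| * ‖y‖)|) '' range (w i)).Finite := (hfin i).image _
      obtain ⟨C, hC⟩ := h1.bddAbove
      exact ⟨C, fun n => hC ⟨w i n, ⟨n, rfl⟩, rfl⟩⟩
    obtain ⟨C, hC⟩ := hbdd
    have hinv : Tendsto (fun n : ℤ => (1 / (n : ℝ))) cofinite (𝓝 0) := by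
      simp only [one_div]
      refine tendsto_inv₀_cobounded.comp ?_
      rw [Metric.cobounded_eq_cocompact]
      exact Int.tendsto_coe_cofinite
    have h2 : Tendsto (fun n : ℤ => χ i + (1 / (n : ℝ)) * Real.log (|r| * ‖w i n‖)) cofinite
        (𝓝 (χ i + 0)) := by
      refine tendsto_const_nhds.add ?_
      refine squeeze_zero_norm (a := fun n : ℤ => ‖1 / (n : ℝ)‖ * C) (fun n => ?_) ?_
      · rw [norm_mul]
        exact mul_le_mul_of_nonneg_left (hC n) (norm_nonneg _)
      · simpa using hinv.norm.mul_const C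
    rw [add_zero] at h2
    refine h2.congr' ?_
    filter_upwards [eventually_cofinite_ne (0 : ℤ)] with n hn
    refine Eq.trans ?_ (congrArg (fun t => (1 / (n : ℝ)) * t) (hnorm n)).symm
    rw [mul_add, ← mul_assoc, one_div, inv_mul_cancel₀ (by exact_mod_cast hn), one_mul]

end Dyn

/-! ### The action of the lift in eigencoordinates -/

/-- The diagonal linear map of the plane with entries `a`, `b`. -/
def diagMap (a b : ℝ) : Plane →L[ℝ] Plane :=
  LinearMap.toContinuousLinearMap (Matrix.toLin' (Matrix.diagonal ![a, b]))

theorem diagMap_apply (a b : ℝ) (y : Plane) : diagMap a b y = ![a * y 0, b * y 1] := by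
  ext k
  fin_cases k <;> simp [diagMap, Matrix.mulVec_diagonal]

theorem diagMap_pow (a b : ℝ) (k : ℕ) : diagMap a b ^ k = diagMap (a ^ k) (b ^ k) := by
  induction k with
  | zero =>
    ext y i
    fin_cases i <;> simp [diagMap_apply]
  | succ k ih =>
    rw [pow_succ, ih]
    ext y i
    fin_cases i <;> simp [diagMap_apply, mul_apply_eq_comp, pow_succ, mul_assoc]

theorem tendsto_diagMap_pow_iff (a b : ℝ) (y : Plane) :
    Tendsto (fun k : ℕ => (diagMap a b ^ k) y) atTop (𝓝 0) ↔
      Tendsto (fun k : ℕ => a ^ k * y 0) atTop (𝓝 0) ∧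
        Tendsto (fun k : ℕ => b ^ k * y 1) atTop (𝓝 0) := by
  simp only [diagMap_pow, diagMap_apply]
  rw [tendsto_pi_nhds, Fin.forall_fin_two]
  simp

theorem tendsto_pow_mul_of_lt_one {a : ℝ} (h0 : 0 ≤ a) (h : a < 1) (x : ℝ) :
    Tendsto (fun k : ℕ => a ^ k * x) atTop (𝓝 0) := by
  simpa using (tendsto_pow_atTop_nhds_zero_of_lt_one h0 h).mul_const x

theorem tendsto_pow_mul_iff_of_one_lt {a : ℝ} (h : 1 < a) (x : ℝ) :
    Tendsto (fun k : ℕ => a ^ k * x) atTop (𝓝 0) ↔ x = 0 := by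
  refine ⟨fun hx => ?_, fun hx => by simp [hx]⟩
  have h1 := (tendsto_pow_mul_of_lt_one (inv_nonneg.2 (by linarith)) (inv_lt_one_of_one_lt₀ h)
    1).mul hx
  have h2 : (fun k : ℕ => a⁻¹ ^ k * 1 * (a ^ k * x)) = fun _ => x := by
    funext k
    have : a ^ k ≠ 0 := pow_ne_zero _ (by linarith)
    rw [inv_pow]; field_simp
  rw [h2, mul_zero] at h1
  exact tendsto_nhds_unique tendsto_const_nhds h1

namespace Blowup

variable {A : Matrix.SpecialLinearGroup (Fin 2) ℤ}

theorem perm_symm (A : Matrix.SpecialLinearGroup (Fin 2) ℤ) : (perm A).symm = perm A⁻¹ :=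
  Equiv.ext fun _ => rfl

theorem contMDiff_perm (A : Matrix.SpecialLinearGroup (Fin 2) ℤ) :
    ContMDiff 𝓘(ℝ, Plane) 𝓘(ℝ, Plane) ω (perm A) :=
  contMDiff_lift A

theorem mdifferentiable_perm (A : Matrix.SpecialLinearGroup (Fin 2) ℤ) :
    MDifferentiable 𝓘(ℝ, Plane) 𝓘(ℝ, Plane) (perm A) :=
  (contMDiff_perm A).mdifferentiable (by simp)

theorem polar_smul (b d : Plane) {α : ℝ} (hα : α ≠ 0) (β : ℝ) (c : Plane) :
    polar (α • b) (β • d) c = polar b d (diagMap α (β / α) c) := by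
  have h : α • b + c 1 • β • d = α • (b + (β / α * c 1) • d) := by
    rw [smul_add, smul_smul, smul_smul]
    congr 2
    field_simp
  simp only [polar, diagMap_apply, Matrix.cons_val_zero, Matrix.cons_val_one]
  rw [h, line_smul hα, smul_smul, mul_comm α]

theorem perm_polar {b d : Plane} (h : cross b d ≠ 0) {α β : ℝ} (hα : α ≠ 0)
    (hb : planeMap A b = α • b) (hd : planeMap A d = β • d) (c : Plane) :
    perm A (polar b d c) = polar b d (diagMap α (β / α) c) := by
  rw [← polar_smul b d hα, ← hb, ← hd]
  exact lift_polar A h c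

theorem polar_zero (b d : Plane) : polar b d 0 = exceptional (line b) := by
  rw [polar_exceptional b d (by rfl)]
  simp

theorem cross_swap {b d : Plane} (h : cross b d ≠ 0) : cross d b ≠ 0 := by
  intro h'; apply h; unfold cross at *; linarith

theorem eq_smul_add_smul {b d : Plane} (h : cross b d ≠ 0) (v : Plane) :
    v = (cross v d / cross b d) • b + (cross b v / cross b d) • d := by
  ext k
  simp only [Pi.add_apply, Pi.smul_apply, smul_eq_mul]
  field_simp
  unfold cross
  fin_cases k
  · simp only [Fin.zero_eta]; ring
  · simp only [Fin.mk_one]; ring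

/-- A line is either the graph of a slope with respect to the basis `(b, d)`, or spanned by `d`. -/
theorem exceptional_eq_polar {b d : Plane} (h : cross b d ≠ 0) (l : ℙ ℝ Plane) :
    (∃ t : ℝ, exceptional l = polar b d ![0, t]) ∨ exceptional l = polar d b 0 := by
  induction l using Projectivization.ind with
  | h v hv =>
    rw [← line_of_ne_zero hv]
    have e := eq_smul_add_smul h v
    by_cases h0 : cross v d / cross b d = 0
    · right
      rw [h0, zero_smul, zero_add] at e
      rw [polar_zero]
      have h1 : cross b v / cross b d ≠ 0 := by
        intro h1; rw [h1, zero_smul] at e; exact hv e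
      rw [e, line_smul h1]
    · left
      refine ⟨(cross b v / cross b d) / (cross v d / cross b d), ?_⟩
      rw [polar_exceptional b d (by rfl)]
      have e2 : v = (cross v d / cross b d) •
          (b + ((cross b v / cross b d) / (cross v d / cross b d)) • d) := by
        rw [smul_add, smul_smul, mul_div_cancel₀ _ h0]
        exact e
      conv_lhs => rw [e2, line_smul h0]
      rfl

theorem polar_slope_inv {b d : Plane} {t : ℝ} (ht : t ≠ 0) :
    polar b d ![0, t] = polar d b ![0, t⁻¹] := by
  rw [polar_exceptional b d (by rfl), polar_exceptional d b (by rfl)]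
  congr 1
  have : b + t • d = t • (d + t⁻¹ • b) := by
    rw [smul_add, smul_smul, mul_inv_cancel₀ ht, one_smul, add_comm]
  simp only [Matrix.cons_val_one]
  rw [Matrix.cons_val_fin_one, Matrix.cons_val_fin_one, this, line_smul ht]

theorem tendsto_iterate_perm_polar {b d : Plane} (h : cross b d ≠ 0) {α β : ℝ} (hα : α ≠ 0)
    (hb : planeMap A b = α • b) (hd : planeMap A d = β • d) {c : Plane}
    (hc : Tendsto (fun k : ℕ => (diagMap α (β / α) ^ k) c) atTop (𝓝 0)) :
    Tendsto (fun k : ℕ => (perm A)^[k] (polar b d c)) atTop (𝓝 (polar b d 0)) := by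
  simp only [Dyn.iterate_semiconj (perm_polar h hα hb hd)]
  exact (contMDiffAt_polar h (by rfl)).continuousAt.tendsto.comp hc

/-- The derivative at `c` of the linear blow-up coordinates. -/
def polarDeriv (b d c : Plane) : Plane →L[ℝ] Plane := mfderiv 𝓘(ℝ, Plane) 𝓘(ℝ, Plane) (polar b d) c

theorem polarDeriv_injective {b d : Plane} (h : cross b d ≠ 0) {c : Plane} (hc : c 0 = 0) :
    Injective (polarDeriv b d c) :=
  mfderiv_polar_injective h hc

theorem polarDeriv_surjective {b d : Plane} (h : cross b d ≠ 0) {c : Plane} (hc : c 0 = 0) :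
    Surjective (polarDeriv b d c) :=
  (LinearMap.injective_iff_surjective (f := (polarDeriv b d c : Plane →ₗ[ℝ] Plane))).1
    (polarDeriv_injective h hc)

theorem mdifferentiableAt_polar {b d : Plane} (h : cross b d ≠ 0) {c : Plane} (hc : c 0 = 0) :
    MDifferentiableAt 𝓘(ℝ, Plane) 𝓘(ℝ, Plane) (polar b d) c :=
  (contMDiffAt_polar h hc).mdifferentiableAt (by simp)

theorem perm_polar_zero {b d : Plane} (h : cross b d ≠ 0) {α β : ℝ} (hα : α ≠ 0)
    (hb : planeMap A b = α • b) (hd : planeMap A d = β • d) :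
    perm A (polar b d 0) = polar b d 0 := by
  rw [perm_polar h hα hb hd, map_zero]

theorem isHyperbolicPeriodicPt_polar_zero {b d : Plane} (h : cross b d ≠ 0) {α β : ℝ}
    (hα : α ≠ 0) (hb : planeMap A b = α • b) (hd : planeMap A d = β • d) (hα1 : |α| ≠ 1)
    (hβ1 : |β / α| ≠ 1) :
    Dyn.IsHyperbolicPeriodicPt (E := Plane) (perm A) (polar b d 0) := by
  have hfix : IsFixedPt (perm A) (polar b d 0) := perm_polar_zero h hα hb hd
  have hinj := polarDeriv_injective h (c := 0) rfl
  refine Dyn.isHyperbolicPeriodicPt_of_eigenbasis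
    (mk_mem_periodicPts one_pos (hfix.isPeriodicPt 1))
    ((Pi.basisFun ℝ (Fin 2)).map
      (LinearEquiv.ofInjectiveEndo (polarDeriv b d 0 : Plane →ₗ[ℝ] Plane) hinj))
    ![α, β / α] (fun i => ?_) (fun i => ?_)
  · rw [minimalPeriod_eq_one_iff_isFixedPt.2 hfix, iterate_one, Module.Basis.map_apply]
    have h1 := Dyn.tderiv_apply_of_semiconj (c := 0) (.of_forall (perm_polar h hα hb hd))
      (mdifferentiable_perm A _) (mdifferentiableAt_polar h rfl)
      (by rw [map_zero]; exact mdifferentiableAt_polar h rfl) (Pi.basisFun ℝ (Fin 2) i)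
    rw [map_zero] at h1
    refine h1.trans ?_
    have h2 : diagMap α (β / α) (Pi.basisFun ℝ (Fin 2) i) =
        (![α, β / α] : Fin 2 → ℝ) i • Pi.basisFun ℝ (Fin 2) i := by
      ext k
      fin_cases i <;> fin_cases k <;> simp [diagMap_apply]
    rw [h2]
    exact (polarDeriv b d 0).map_smul _ _
  · fin_cases i
    · exact hα1
    · exact hβ1

theorem polarDeriv_mem_stableSpace_iff {b d : Plane} (h : cross b d ≠ 0) {α β : ℝ}
    (hα : α ≠ 0) (hb : planeMap A b = α • b) (hd : planeMap A d = β • d) {c : Plane}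
    (hc0 : c 0 = 0) (hc : Tendsto (fun k : ℕ => (diagMap α (β / α) ^ k) c) atTop (𝓝 0))
    (v : Plane) :
    polarDeriv b d c v ∈ Dyn.stableSpace (E := Plane) (perm A) (polar b d 0) (polar b d c) ↔
      Tendsto (fun k : ℕ => (diagMap α (β / α) ^ k) v) atTop (𝓝 0) := by
  have : IsManifold 𝓘(ℝ, Plane) 1 Blowup := IsManifold.of_le (n := ω) (by simp)
  exact Dyn.mem_stableSpace_iff (mdifferentiable_perm A) (perm_polar h hα hb hd)
    ((contMDiffAt_polar h rfl).of_le (by simp)) (mfderiv_polar_injective h rfl)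
    (mdifferentiableAt_polar h hc0) hc v

/-- If the lift expands the direction transverse to the exceptional fibre at a fixed point and
contracts the fibre, then the stable spaces are tangent to the fibre. -/
theorem stableSpace_polar_of_one_lt {b d : Plane} (h : cross b d ≠ 0) {α β : ℝ}
    (hα : 1 < α) (hb : planeMap A b = α • b) (hd : planeMap A d = β • d)
    (h0 : 0 ≤ β / α) (h1 : β / α < 1) (t : ℝ) :
    Dyn.stableSpace (E := Plane) (perm A) (polar b d 0) (polar b d ![0, t]) =
      Submodule.span ℝ {(polarDeriv b d ![0, t] ![0, 1] : Plane)} := by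
  have hα0 : α ≠ 0 := by linarith
  have hc : Tendsto (fun k : ℕ => (diagMap α (β / α) ^ k) ![0, t]) atTop (𝓝 0) := by
    rw [tendsto_diagMap_pow_iff]
    exact ⟨by simp, tendsto_pow_mul_of_lt_one h0 h1 _⟩
  ext x
  obtain ⟨v, rfl⟩ := polarDeriv_surjective h (c := ![0, t]) rfl x
  refine (polarDeriv_mem_stableSpace_iff h hα0 hb hd (c := ![0, t]) rfl hc v).trans ?_
  rw [tendsto_diagMap_pow_iff, tendsto_pow_mul_iff_of_one_lt hα]
  constructor
  · rintro ⟨hv, -⟩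
    refine (Submodule.mem_span_singleton (R := ℝ) (M := Plane)).2 ⟨v 1, ?_⟩
    refine ((polarDeriv b d ![0, t]).map_smul (v 1) ![0, 1]).symm.trans ?_
    congr 1
    ext k
    fin_cases k <;> simp [hv]
  · intro hv
    obtain ⟨r, hr⟩ := (Submodule.mem_span_singleton (R := ℝ) (M := Plane)).1 hv
    have h2 : r • ![0, 1] = v := polarDeriv_injective h (c := ![0, t]) rfl
      (((polarDeriv b d ![0, t]).map_smul r ![0, 1]).trans hr)
    refine ⟨?_, tendsto_pow_mul_of_lt_one h0 h1 _⟩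
    rw [← h2]; simp

/-- If the lift contracts the direction transverse to the exceptional fibre at a fixed point and
expands the fibre, then the stable space is transverse to the fibre. -/
theorem stableSpace_polar_of_lt_one {b d : Plane} (h : cross b d ≠ 0) {α β : ℝ}
    (hα0 : 0 < α) (hα : α < 1) (hb : planeMap A b = α • b) (hd : planeMap A d = β • d)
    (h1 : 1 < β / α) :
    Dyn.stableSpace (E := Plane) (perm A) (polar b d 0) (polar b d 0) =
      Submodule.span ℝ {(polarDeriv b d 0 ![1, 0] : Plane)} := by
  have hc : Tendsto (fun k : ℕ => (diagMap α (β / α) ^ k) 0) atTop (𝓝 0) := by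
    simp
  ext x
  obtain ⟨v, rfl⟩ := polarDeriv_surjective h (c := 0) rfl x
  refine (polarDeriv_mem_stableSpace_iff h hα0.ne' hb hd (c := 0) rfl hc v).trans ?_
  rw [tendsto_diagMap_pow_iff, tendsto_pow_mul_iff_of_one_lt h1]
  constructor
  · rintro ⟨-, hv⟩
    refine (Submodule.mem_span_singleton (R := ℝ) (M := Plane)).2 ⟨v 0, ?_⟩
    refine ((polarDeriv b d 0).map_smul (v 0) ![1, 0]).symm.trans ?_
    congr 1
    ext k
    fin_cases k <;> simp [hv]
  · intro hv
    obtain ⟨r, hr⟩ := (Submodule.mem_span_singleton (R := ℝ) (M := Plane)).1 hv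
    have h2 : r • ![1, 0] = v := polarDeriv_injective h (c := 0) rfl
      (((polarDeriv b d 0).map_smul r ![1, 0]).trans hr)
    refine ⟨tendsto_pow_mul_of_lt_one hα0.le hα _, ?_⟩
    rw [← h2]; simp

/-- The two linear blow-up coordinates `polar b d` and `polar d b` have the same tangent direction
along the exceptional fibre. -/
theorem exists_polarDeriv_eq_smul {b d : Plane} (h : cross b d ≠ 0) {t : ℝ} (ht : t ≠ 0) :
    ∃ r : ℝ, polarDeriv b d ![0, t] ![0, 1] = r • polarDeriv d b ![0, t⁻¹] ![0, 1] := by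
  have hι : ∀ s : ℝ, HasFDerivAt (fun τ : ℝ => (![0, τ] : Plane))
      (ContinuousLinearMap.toSpanSingleton ℝ ![0, 1]) s := by
    intro s
    rw [hasFDerivAt_pi']
    intro k
    fin_cases k
    · refine (hasFDerivAt_const (0 : ℝ) s).congr_fderiv ?_
      ext; simp
    · refine (hasFDerivAt_id s).congr_fderiv ?_
      ext; simp
  have h1 := (mdifferentiableAt_polar h (c := ![0, t]) rfl).hasMFDerivAt.comp t
    (hι t).hasMFDerivAt
  have h2 := (mdifferentiableAt_polar (cross_swap h) (c := ![0, t⁻¹]) rfl).hasMFDerivAt.comp t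
    ((hι t⁻¹).comp t (hasDerivAt_inv ht).hasFDerivAt).hasMFDerivAt
  have h3 : (polar b d ∘ fun τ : ℝ => (![0, τ] : Plane)) =ᶠ[𝓝 t]
      (polar d b ∘ (fun τ : ℝ => (![0, τ] : Plane)) ∘ fun τ : ℝ => τ⁻¹) := by
    filter_upwards [isOpen_ne.mem_nhds ht] with τ hτ
    exact polar_slope_inv hτ
  have h4 := congrArg (fun T : ℝ →L[ℝ] Plane => T 1)
    (hasMFDerivAt_unique h1 (h2.congr_of_eventuallyEq h3))
  refine ⟨-(t ^ 2)⁻¹, ?_⟩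
  refine Eq.trans ?_ (h4.trans ?_)
  · change _ = polarDeriv b d ![0, t] ((1 : ℝ) • ![0, 1])
    rw [one_smul]
  · change polarDeriv d b ![0, t⁻¹] (((1 : ℝ) • (-(t ^ 2)⁻¹)) • ![0, 1]) = _
    rw [one_smul, map_smul]

end Blowup

/-! ### Stable sets and homoclinic classes -/

namespace Dyn

theorem mem_stableSet_of_fixed {X : Type*} [TopologicalSpace X] {f : Equiv.Perm X} {p : X}
    (hp : f p = p) (y : X) : y ∈ stableSet f p ↔ Tendsto (fun k : ℕ => f^[k] y) atTop (𝓝 p) := by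
  have hm : minimalPeriod f p = 1 := minimalPeriod_eq_one_iff_isFixedPt.2 hp
  simp only [stableSet, hm, one_mul, mem_ofPred_eq]

theorem symm_fixed {X : Type*} {f : Equiv.Perm X} {p : X} (hp : f p = p) : f.symm p = p := by
  rw [Equiv.symm_apply_eq, hp]

theorem mem_transverseIntersection_of_fixed {E M : Type*} [NormedAddCommGroup E] [NormedSpace ℝ E]
    [TopologicalSpace M] [ChartedSpace E M] {f : Equiv.Perm M} {p q : M} (hp : f p = p)
    (hq : f q = q) (x : M) : x ∈ transverseIntersection (E := E) f p q ↔
      x ∈ stableSet f p ∧ x ∈ stableSet f.symm q ∧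
        stableSpace (E := E) f p x ⊔ stableSpace (E := E) f.symm q x = ⊤ := by
  simp only [transverseIntersection, iterate_fixed hp, iterate_fixed hq, exists_const, unstableSet,
    unstableSpace, mem_ofPred_eq]

theorem transverseIntersection_symm {E M : Type*} [NormedAddCommGroup E] [NormedSpace ℝ E]
    [TopologicalSpace M] [ChartedSpace E M] {f : Equiv.Perm M} {p q : M} (hp : f p = p)
    (hq : f q = q) :
    transverseIntersection (E := E) f.symm p q = transverseIntersection (E := E) f q p := by
  ext x
  rw [mem_transverseIntersection_of_fixed (symm_fixed hp) (symm_fixed hq),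
    mem_transverseIntersection_of_fixed hq hp, Equiv.symm_symm, sup_comm]
  tauto

theorem mem_periodicPts_symm {X : Type*} {f : Equiv.Perm X} {q : X} (hq : q ∈ periodicPts f) :
    q ∈ periodicPts f.symm := by
  obtain ⟨n, hn, h⟩ := hq
  refine ⟨n, hn, ?_⟩
  have h1 := (f.left_inv.iterate n) q
  change f.symm^[n] (f^[n] q) = q at h1
  rwa [h.eq] at h1

theorem iterate_mem_periodicPts {X : Type*} {f : X → X} {q : X} (hq : q ∈ periodicPts f) (j : ℕ) :
    f^[j] q ∈ periodicPts f := by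
  obtain ⟨n, hn, h⟩ := hq
  exact ⟨n, hn, h.apply_iterate j⟩

theorem eq_of_iterate_eq_fixed {X : Type*} {f : Equiv.Perm X} {p q : X} (hp : f p = p) {j : ℕ}
    (h : f^[j] q = p) : q = p :=
  f.injective.iterate j (by rw [h, iterate_fixed hp])

end Dyn

namespace Blowup

/-- `A` is hyperbolic, with the eigenvectors `u` and `w` for the eigenvalues `lam > 1` and
`lam⁻¹`. -/
structure Saddle (A : Matrix.SpecialLinearGroup (Fin 2) ℤ) (lam : ℝ) (u w : Plane) : Prop where
  one_lt : 1 < lam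
  cross_ne : cross u w ≠ 0
  map_u : planeMap A u = lam • u
  map_w : planeMap A w = lam⁻¹ • w

theorem planeMap_inv_of_eigen {A : Matrix.SpecialLinearGroup (Fin 2) ℤ} {v : Plane} {r : ℝ}
    (hr : r ≠ 0) (h : planeMap A v = r • v) : planeMap A⁻¹ v = r⁻¹ • v := by
  have h1 : planeMap A⁻¹ (planeMap A v) = v := by
    rw [← planeMap_mul, inv_mul_cancel, planeMap_one]
  rw [h, map_smul] at h1
  rw [eq_inv_smul_iff₀ hr, h1]

namespace Saddle

variable {A : Matrix.SpecialLinearGroup (Fin 2) ℤ} {lam : ℝ} {u w : Plane}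

theorem pos (H : Saddle A lam u w) : 0 < lam := one_pos.trans H.one_lt

theorem ne_zero (H : Saddle A lam u w) : lam ≠ 0 := H.pos.ne'

theorem inv_ne_zero (H : Saddle A lam u w) : lam⁻¹ ≠ 0 := _root_.inv_ne_zero H.ne_zero

/-- The inverse of `A` has the same eigenlines, with the two eigenvalues exchanged.  This is the
symmetry that exchanges the roles of the two fixed points on the exceptional fibre. -/
theorem symm (H : Saddle A lam u w) : Saddle A⁻¹ lam w u :=
  ⟨H.one_lt, cross_swap H.cross_ne, by
    simpa using planeMap_inv_of_eigen H.inv_ne_zero H.map_w,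
    planeMap_inv_of_eigen H.ne_zero H.map_u⟩

theorem inv_lt_one (H : Saddle A lam u w) : lam⁻¹ < 1 := inv_lt_one_of_one_lt₀ H.one_lt

theorem ratio_pos (H : Saddle A lam u w) : 0 ≤ lam⁻¹ / lam :=
  div_nonneg (inv_nonneg.2 H.pos.le) H.pos.le

theorem ratio_lt_one (H : Saddle A lam u w) : lam⁻¹ / lam < 1 := by
  rw [div_lt_one H.pos]
  exact H.inv_lt_one.trans H.one_lt

theorem one_lt_ratio (H : Saddle A lam u w) : 1 < lam / lam⁻¹ := by
  rw [one_lt_div (inv_pos.2 H.pos)]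
  exact H.inv_lt_one.trans H.one_lt

theorem perm_u (H : Saddle A lam u w) : perm A (polar u w 0) = polar u w 0 :=
  perm_polar_zero H.cross_ne H.ne_zero H.map_u H.map_w

theorem perm_w (H : Saddle A lam u w) : perm A (polar w u 0) = polar w u 0 :=
  perm_polar_zero (cross_swap H.cross_ne) H.inv_ne_zero H.map_w H.map_u

theorem polar_ne (H : Saddle A lam u w) : polar u w 0 ≠ polar w u 0 := by
  rw [polar_zero, polar_zero]
  intro h
  have hu : u ≠ 0 := fun h => H.cross_ne (by simp [cross, h])
  have hw : w ≠ 0 := fun h => H.cross_ne (by simp [cross, h])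
  rw [line_of_ne_zero hu, line_of_ne_zero hw] at h
  injection h with h
  obtain ⟨r, hr⟩ := (Projectivization.mk_eq_mk_iff' ℝ _ _ _ _).1 h
  apply H.cross_ne
  rw [← hr]
  simp only [cross, Pi.smul_apply, smul_eq_mul]
  ring

/-- Every line other than the one of `w` is attracted by the line of `u`. -/
theorem tendsto_slope (H : Saddle A lam u w) (t : ℝ) :
    Tendsto (fun k : ℕ => (perm A)^[k] (polar u w ![0, t])) atTop (𝓝 (polar u w 0)) := by
  refine tendsto_iterate_perm_polar H.cross_ne H.ne_zero H.map_u H.map_w ?_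
  rw [tendsto_diagMap_pow_iff]
  exact ⟨by simp, tendsto_pow_mul_of_lt_one H.ratio_pos H.ratio_lt_one _⟩

/-- The points of the stable eigenline of `A` off the origin converge to the line of `w`. -/
theorem tendsto_radial (H : Saddle A lam u w) (s : ℝ) :
    Tendsto (fun k : ℕ => (perm A)^[k] (polar w u ![s, 0])) atTop (𝓝 (polar w u 0)) := by
  refine tendsto_iterate_perm_polar (cross_swap H.cross_ne) H.inv_ne_zero H.map_w H.map_u ?_
  rw [tendsto_diagMap_pow_iff]
  exact ⟨tendsto_pow_mul_of_lt_one (inv_nonneg.2 H.pos.le) H.inv_lt_one _, by simp⟩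

theorem planeMap_iterate (H : Saddle A lam u w) (α β : ℝ) (k : ℕ) :
    (planeMap A)^[k] (α • u + β • w) = (lam ^ k * α) • u + (lam⁻¹ ^ k * β) • w := by
  induction k with
  | zero => simp
  | succ k ih =>
    rw [iterate_succ_apply', ih, map_add, map_smul, map_smul, H.map_u, H.map_w, smul_smul,
      smul_smul]
    congr 2 <;> ring

end Saddle

theorem isOpenMap_toTorus : IsOpenMap toTorus :=
  IsOpenMap.piMap (fun _ => QuotientAddGroup.isOpenMap_coe) (by simp)

theorem proj_iterate_perm (A : Matrix.SpecialLinearGroup (Fin 2) ℤ) (k : ℕ) (x : Blowup) :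
    proj ((perm A)^[k] x) = (torusEnd A)^[k] (proj x) := by
  induction k generalizing x with
  | zero => rfl
  | succ k ih =>
    rw [iterate_succ_apply, ih, iterate_succ_apply]
    exact congrArg _ (proj_lift A x)

/-- A point of the torus whose orbit tends to zero is eventually on the local stable manifold,
which is a segment of the stable eigenline. -/
theorem Saddle.exists_iterate_eq_stable {A : Matrix.SpecialLinearGroup (Fin 2) ℤ} {lam : ℝ}
    {u w : Plane} (H : Saddle A lam u w) {z : Torus}
    (hz : Tendsto (fun k : ℕ => (torusEnd A)^[k] z) atTop (𝓝 0)) :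
    ∃ (K : ℕ) (β : ℝ), (torusEnd A)^[K] z = toTorus (β • w) := by
  -- The set `U` is chosen so small that `U` and its image lie in a box which projects injectively
  -- to the torus; so lifts to `U` of consecutive points of the orbit are related by `A`.
  have hcont : Continuous (planeMap A) := (planeMap A).continuous_of_finiteDimensional
  set U : Set Plane := Metric.ball 0 (1 / 2) ∩ planeMap A ⁻¹' Metric.ball 0 (1 / 2) with hU
  have hUo : IsOpen U := Metric.isOpen_ball.inter (Metric.isOpen_ball.preimage hcont)
  have hbox : ∀ v ∈ Metric.ball (0 : Plane) (1 / 2), ∀ i, |v i| < 1 / 2 := fun v hv i => by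
    rw [mem_ball_zero_iff] at hv
    exact (norm_le_pi_norm v i).trans_lt hv
  have h0 : (0 : Torus) ∈ toTorus '' U := ⟨0, by simp [hU], toTorus_zero⟩
  obtain ⟨K, hK⟩ := eventually_atTop.1 (hz.eventually_mem ((isOpenMap_toTorus U hUo).mem_nhds h0))
  choose! v hvU hv using hK
  have hstep : ∀ j, v (K + j) = (planeMap A)^[j] (v K) := by
    intro j
    induction j with
    | zero => rfl
    | succ j ih =>
      rw [iterate_succ_apply', ← ih]
      refine toTorus_inj_box ?_ (hbox _ (hvU _ (by omega)).1) (hbox _ (hvU (K + j) (by omega)).2)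
      rw [← torusEnd_toTorus, hv _ (by omega), hv _ (by omega),
        ← iterate_succ_apply' (torusEnd A)]
      rfl
  set α := cross (v K) w / cross u w with hα
  set β := cross u (v K) / cross u w with hβ
  have hdec : v K = α • u + β • w := eq_smul_add_smul H.cross_ne (v K)
  refine ⟨K, β, ?_⟩
  have hα0 : α = 0 := by
    by_contra hne
    -- the component along `u` grows exponentially, while the lifts stay bounded
    have hb : ∀ j, lam ^ j * |α * cross u w| ≤ |w 0| + |w 1| := by
      intro j
      have h1 := hstep j
      rw [hdec, H.planeMap_iterate] at h1
      have h2 := hbox _ (hvU (K + j) (by omega)).1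
      have h3 : cross (v (K + j)) w = lam ^ j * (α * cross u w) := by
        rw [h1]
        simp only [cross, Pi.add_apply, Pi.smul_apply, smul_eq_mul]
        ring
      have h4 : |cross (v (K + j)) w| = lam ^ j * |α * cross u w| := by
        rw [h3, abs_mul, abs_of_pos (pow_pos H.pos j)]
      rw [← h4]
      have h5 : |v (K + j) 0 * w 1| ≤ |w 1| := by
        rw [abs_mul]
        nlinarith [h2 0, abs_nonneg (w 1), abs_nonneg (v (K + j) 0)]
      have h6 : |v (K + j) 1 * w 0| ≤ |w 0| := by
        rw [abs_mul]
        nlinarith [h2 1, abs_nonneg (w 0), abs_nonneg (v (K + j) 1)]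
      have h7 := abs_sub (v (K + j) 0 * w 1) (v (K + j) 1 * w 0)
      unfold cross
      linarith
    have hpos : 0 < |α * cross u w| := abs_pos.2 (mul_ne_zero hne H.cross_ne)
    have ht := (tendsto_pow_atTop_atTop_of_one_lt H.one_lt).atTop_mul_const hpos
    obtain ⟨j, hj⟩ := (ht.eventually (eventually_gt_atTop (|w 0| + |w 1|))).exists
    exact absurd (hb j) (not_le.2 hj)
  rw [hα0, zero_smul, zero_add] at hdec
  rw [← hv K le_rfl, hdec]

namespace Saddle

variable {A : Matrix.SpecialLinearGroup (Fin 2) ℤ} {lam : ℝ} {u w : Plane}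

/-- The stable set of the line of `u` lies in the exceptional fibre. -/
theorem exists_slope_of_mem_stableSet (H : Saddle A lam u w) {x : Blowup}
    (hx : x ∈ Dyn.stableSet (perm A) (polar u w 0)) : ∃ t : ℝ, x = polar u w ![0, t] := by
  rw [Dyn.mem_stableSet_of_fixed H.perm_u] at hx
  rcases x with ⟨z, hz⟩ | l
  · exfalso
    have h1 : Tendsto (fun k : ℕ => (torusEnd A)^[k] z) atTop (𝓝 0) := by
      have h2 := (continuous_proj.tendsto _).comp hx
      rw [polar_zero] at h2
      refine h2.congr fun k => ?_
      rw [comp_apply, proj_iterate_perm]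
      rfl
    obtain ⟨K, β, hK⟩ := H.exists_iterate_eq_stable h1
    have h3 : (perm A)^[K] (regular z hz) = polar w u ![β, 0] := by
      have h4 : proj ((perm A)^[K] (regular z hz)) ≠ 0 := by
        have : ∀ j, (torusEnd A)^[j] z ≠ 0 := by
          intro j
          induction j with
          | zero => exact hz
          | succ j ih => rw [iterate_succ_apply']; exact torusEnd_ne_zero A ih
        rw [proj_iterate_perm]
        exact this K
      have h5 : proj ((perm A)^[K] (regular z hz)) = toTorus (β • w) := by
        rw [proj_iterate_perm, ← hK]
        rfl
      have h6 : polar w u ![β, 0] = Blowup.mk (β • w) (line w) := by simp [polar]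
      rw [h6]
      generalize (perm A)^[K] (regular z hz) = y at h4 h5
      rcases y with ⟨y, hy⟩ | l
      · change y = _ at h5
        subst h5
        simp [Blowup.mk, hy]
      · exact absurd rfl h4
    have h7 := H.tendsto_radial β
    rw [← h3] at h7
    have h8 : Tendsto (fun k : ℕ => (perm A)^[k] ((perm A)^[K] (regular z hz))) atTop
        (𝓝 (polar u w 0)) := by
      refine (hx.comp (tendsto_add_atTop_nat K)).congr fun k => ?_
      rw [comp_apply, iterate_add_apply]
    exact H.polar_ne (tendsto_nhds_unique h8 h7)
  · rcases exceptional_eq_polar H.cross_ne l with h | h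
    · exact h
    · exfalso
      rw [h] at hx
      simp only [iterate_fixed H.perm_w] at hx
      exact H.polar_ne (tendsto_nhds_unique hx tendsto_const_nhds)

/-- The backward orbits in the stable set of the line of `u` are attracted by the line of `w`,
except for the fixed one. -/
theorem eq_or_eq_of_tendsto (H : Saddle A lam u w) {t : ℝ} {q : Blowup} {m : ℕ} (hm : 0 < m)
    (hx : Tendsto (fun k : ℕ => (perm A⁻¹)^[m * k] (polar u w ![0, t])) atTop (𝓝 q)) :
    (t = 0 ∧ q = polar u w 0) ∨ (t ≠ 0 ∧ q = polar w u 0) := by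
  by_cases ht : t = 0
  · left
    have h0 : (![0, t] : Plane) = 0 := by rw [ht]; ext k; fin_cases k <;> rfl
    rw [h0] at hx
    simp only [iterate_fixed H.symm.perm_w] at hx
    exact ⟨ht, tendsto_nhds_unique hx tendsto_const_nhds⟩
  · right
    refine ⟨ht, tendsto_nhds_unique hx ?_⟩
    rw [polar_slope_inv ht]
    exact (H.symm.tendsto_slope t⁻¹).comp (tendsto_id.const_mul_atTop' hm)

theorem eq_or_eq_of_mem_stableSet (H : Saddle A lam u w) {x q : Blowup}
    (hq : q ∈ periodicPts (perm A⁻¹)) (hx : x ∈ Dyn.stableSet (perm A) (polar u w 0))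
    (hx' : x ∈ Dyn.stableSet (perm A⁻¹) q) :
    (x = polar u w 0 ∧ q = polar u w 0) ∨
      q = polar w u 0 ∧ ∃ t : ℝ, t ≠ 0 ∧ x = polar u w ![0, t] := by
  obtain ⟨t, rfl⟩ := H.exists_slope_of_mem_stableSet hx
  rcases H.eq_or_eq_of_tendsto (minimalPeriod_pos_of_mem_periodicPts hq) hx' with
    ⟨h1, h2⟩ | ⟨h1, h2⟩
  · left
    refine ⟨?_, h2⟩
    rw [h1]
    congr 1
    ext k; fin_cases k <;> rfl
  · exact Or.inr ⟨h2, t, h1, rfl⟩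

theorem mem_periodicPts_w (H : Saddle A lam u w) : polar w u 0 ∈ periodicPts (perm A) :=
  mk_mem_periodicPts one_pos (IsFixedPt.isPeriodicPt (f := perm A) H.perm_w 1)

theorem mem_periodicPts_u (H : Saddle A lam u w) : polar u w 0 ∈ periodicPts (perm A) :=
  mk_mem_periodicPts one_pos (IsFixedPt.isPeriodicPt (f := perm A) H.perm_u 1)

/-- The line of `u` has no homoclinic points, and at this point itself its stable space, tangent to
the exceptional fibre, is transverse to its unstable space. -/
theorem transverseIntersection_u (H : Saddle A lam u w) :
    Dyn.transverseIntersection (E := Plane) (perm A) (polar u w 0) (polar u w 0) =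
      {polar u w 0} := by
  ext x
  rw [Dyn.mem_transverseIntersection_of_fixed H.perm_u H.perm_u, mem_singleton_iff, perm_symm]
  constructor
  · rintro ⟨h1, h2, -⟩
    rcases H.eq_or_eq_of_mem_stableSet H.symm.mem_periodicPts_w h1 h2 with h | h
    · exact h.1
    · exact absurd h.1 H.polar_ne
  · rintro rfl
    refine ⟨?_, ?_, ?_⟩
    · rw [Dyn.mem_stableSet_of_fixed H.perm_u]
      simp only [iterate_fixed H.perm_u]
      exact tendsto_const_nhds
    · rw [Dyn.mem_stableSet_of_fixed H.symm.perm_w]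
      simp only [iterate_fixed H.symm.perm_w]
      exact tendsto_const_nhds
    · have h0 : (![0, 0] : Plane) = 0 := by ext k; fin_cases k <;> rfl
      have h1 := stableSpace_polar_of_one_lt H.cross_ne H.one_lt H.map_u H.map_w H.ratio_pos
        H.ratio_lt_one 0
      rw [h0] at h1
      have h2 := stableSpace_polar_of_lt_one H.cross_ne (inv_pos.2 H.pos) H.inv_lt_one
        H.symm.map_w H.symm.map_u H.one_lt_ratio
      rw [h1, h2, eq_top_iff]
      intro y _
      obtain ⟨v, rfl⟩ := polarDeriv_surjective H.cross_ne (c := 0) rfl y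
      have h3 : polarDeriv u w 0 v =
          v 1 • polarDeriv u w 0 ![0, 1] + v 0 • polarDeriv u w 0 ![1, 0] := by
        rw [← map_smul, ← map_smul, ← map_add]
        congr 1
        ext k; fin_cases k <;> simp
      have h4 : polarDeriv u w 0 v ∈ Submodule.span ℝ {(polarDeriv u w 0 ![0, 1] : Plane)} ⊔
          Submodule.span ℝ {(polarDeriv u w 0 ![1, 0] : Plane)} := by
        rw [h3]
        exact Submodule.add_mem_sup
          (Submodule.smul_mem _ _ (Submodule.mem_span_singleton_self _))
          (Submodule.smul_mem _ _ (Submodule.mem_span_singleton_self _))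
      exact h4

/-- The stable set of the line of `u` and the unstable set of the line of `w` meet along the
exceptional fibre, where both are tangent to this fibre. -/
theorem transverseIntersection_u_w (H : Saddle A lam u w) :
    Dyn.transverseIntersection (E := Plane) (perm A) (polar u w 0) (polar w u 0) = ∅ := by
  refine eq_empty_of_forall_notMem fun x hx => ?_
  rw [Dyn.mem_transverseIntersection_of_fixed H.perm_u H.perm_w, perm_symm] at hx
  obtain ⟨h1, h2, h3⟩ := hx
  rcases H.eq_or_eq_of_mem_stableSet H.symm.mem_periodicPts_u h1 h2 with h | ⟨-, t, ht, rfl⟩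
  · exact H.polar_ne h.2.symm
  · have e1 := stableSpace_polar_of_one_lt H.cross_ne H.one_lt H.map_u H.map_w H.ratio_pos
      H.ratio_lt_one t
    have e2 := stableSpace_polar_of_one_lt H.symm.cross_ne H.one_lt H.symm.map_u H.symm.map_w
      H.ratio_pos H.ratio_lt_one t⁻¹
    rw [← polar_slope_inv ht] at e2
    rw [e1, e2] at h3
    obtain ⟨r, hr⟩ := exists_polarDeriv_eq_smul H.cross_ne ht
    have h4 : (Submodule.span ℝ {(polarDeriv u w ![0, t] ![0, 1] : Plane)} ⊔
        Submodule.span ℝ {(polarDeriv w u ![0, t⁻¹] ![0, 1] : Plane)}) = ⊤ := h3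
    rw [sup_eq_right.2] at h4
    · have h5 := finrank_span_le_card (R := ℝ)
        {(polarDeriv w u ![0, t⁻¹] ![0, 1] : Plane)}
      rw [h4, finrank_top] at h5
      simp at h5
    · rw [hr]
      exact (Submodule.span_singleton_le_iff_mem _ _).2
        (Submodule.smul_mem _ _ (Submodule.mem_span_singleton_self _))

theorem isHyperbolicPeriodicPt_u (H : Saddle A lam u w) :
    Dyn.IsHyperbolicPeriodicPt (E := Plane) (perm A) (polar u w 0) := by
  refine isHyperbolicPeriodicPt_polar_zero H.cross_ne H.ne_zero H.map_u H.map_w ?_ ?_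
  · rw [abs_of_pos H.pos]
    exact H.one_lt.ne'
  · rw [abs_of_nonneg H.ratio_pos]
    exact H.ratio_lt_one.ne

theorem isHyperbolicPeriodicPt_w (H : Saddle A lam u w) :
    Dyn.IsHyperbolicPeriodicPt (E := Plane) (perm A) (polar w u 0) := by
  refine isHyperbolicPeriodicPt_polar_zero (cross_swap H.cross_ne) H.inv_ne_zero H.map_w H.map_u
    ?_ ?_
  · rw [abs_of_pos (inv_pos.2 H.pos)]
    exact H.inv_lt_one.ne
  · rw [abs_of_pos (one_pos.trans H.one_lt_ratio)]
    exact H.one_lt_ratio.ne'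

theorem stableIndex_u (H : Saddle A lam u w) :
    Dyn.stableIndex (E := Plane) (perm A) (polar u w 0) = 1 := by
  have h0 : (![0, 0] : Plane) = 0 := by ext k; fin_cases k <;> rfl
  have h1 := stableSpace_polar_of_one_lt H.cross_ne H.one_lt H.map_u H.map_w H.ratio_pos
    H.ratio_lt_one 0
  rw [h0] at h1
  unfold Dyn.stableIndex
  rw [h1]
  refine finrank_span_singleton (K := ℝ) (V := Plane) ?_
  rw [Ne, map_eq_zero_iff _ (polarDeriv_injective H.cross_ne rfl)]
  exact fun h => by simpa using congrFun h 1

theorem stableIndex_w (H : Saddle A lam u w) :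
    Dyn.stableIndex (E := Plane) (perm A) (polar w u 0) = 1 := by
  have h1 := stableSpace_polar_of_lt_one (cross_swap H.cross_ne) (inv_pos.2 H.pos) H.inv_lt_one
    H.map_w H.map_u H.one_lt_ratio
  unfold Dyn.stableIndex
  rw [h1]
  refine finrank_span_singleton (K := ℝ) (V := Plane) ?_
  rw [Ne, map_eq_zero_iff _ (polarDeriv_injective (cross_swap H.cross_ne) rfl)]
  exact fun h => by simpa using congrFun h 0

theorem transverseIntersection_w (H : Saddle A lam u w) :
    Dyn.transverseIntersection (E := Plane) (perm A) (polar w u 0) (polar w u 0) =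
      {polar w u 0} := by
  rw [← Dyn.transverseIntersection_symm H.perm_w H.perm_w, perm_symm]
  exact H.symm.transverseIntersection_u

theorem not_homoclinicallyRelated (H : Saddle A lam u w) :
    ¬ Dyn.HomoclinicallyRelated (E := Plane) (perm A) (polar u w 0) (polar w u 0) := by
  rintro ⟨h, -⟩
  rw [H.transverseIntersection_u_w] at h
  exact not_nonempty_empty h

theorem intersectionClass_u (H : Saddle A lam u w) :
    Dyn.intersectionClass (E := Plane) (perm A) (polar u w 0) = {polar u w 0} := by
  ext q
  rw [mem_singleton_iff]
  constructor
  · rintro ⟨⟨hq, -⟩, hrel⟩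
    obtain ⟨x, i, j, h1, h2, -⟩ := hrel.1
    rw [iterate_fixed H.perm_u] at h1
    have hq' := Dyn.mem_periodicPts_symm (Dyn.iterate_mem_periodicPts hq j)
    rw [Dyn.unstableSet, perm_symm] at h2
    rw [perm_symm] at hq'
    rcases H.eq_or_eq_of_mem_stableSet hq' h1 h2 with h | h
    · exact Dyn.eq_of_iterate_eq_fixed H.perm_u h.2
    · obtain rfl := Dyn.eq_of_iterate_eq_fixed H.perm_w h.1
      exact absurd hrel H.not_homoclinicallyRelated
  · rintro rfl
    refine ⟨H.isHyperbolicPeriodicPt_u, ?_⟩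
    simp [Dyn.HomoclinicallyRelated, H.transverseIntersection_u]

theorem intersectionClass_w (H : Saddle A lam u w) :
    Dyn.intersectionClass (E := Plane) (perm A) (polar w u 0) = {polar w u 0} := by
  ext q
  rw [mem_singleton_iff]
  constructor
  · rintro ⟨⟨hq, -⟩, hrel⟩
    obtain ⟨x, i, j, h1, h2, -⟩ := hrel.2
    rw [iterate_fixed H.perm_w, Dyn.unstableSet, perm_symm] at h2
    have hq' := Dyn.iterate_mem_periodicPts hq i
    rw [← inv_inv A] at hq' h1
    rcases H.symm.eq_or_eq_of_mem_stableSet hq' h2 h1 with h | h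
    · rw [inv_inv] at h
      exact Dyn.eq_of_iterate_eq_fixed H.perm_w h.2
    · rw [inv_inv] at h
      obtain rfl := Dyn.eq_of_iterate_eq_fixed H.perm_u h.1
      exact absurd ⟨hrel.2, hrel.1⟩ H.not_homoclinicallyRelated
  · rintro rfl
    refine ⟨H.isHyperbolicPeriodicPt_w, ?_⟩
    simp [Dyn.HomoclinicallyRelated, H.transverseIntersection_w]

end Saddle

end Blowup

/-! ### Periodic points off the exceptional fibre -/

theorem toTorus_planeMap_congr (A : Matrix.SpecialLinearGroup (Fin 2) ℤ) {v v' : Plane}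
    (h : toTorus v = toTorus v') : toTorus (planeMap A v) = toTorus (planeMap A v') := by
  rw [← torusEnd_toTorus, h, torusEnd_toTorus]

namespace Blowup

theorem perm_mul (A B : Matrix.SpecialLinearGroup (Fin 2) ℤ) : perm (A * B) = perm A * perm B :=
  Equiv.ext fun x => lift_mul A B x

theorem perm_zpow (A : Matrix.SpecialLinearGroup (Fin 2) ℤ) (n : ℤ) : perm A ^ n = perm (A ^ n) :=
  (map_zpow (MonoidHom.mk' perm perm_mul) A n).symm

theorem perm_iterate (A : Matrix.SpecialLinearGroup (Fin 2) ℤ) (k : ℕ) :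
    (perm A)^[k] = perm (A ^ k) := by
  rw [Equiv.Perm.iterate_eq_pow]
  exact congrArg _ (map_pow (MonoidHom.mk' perm perm_mul) A k).symm

/-- The projection of the plane to the blow-up, with a default value at the lattice points. -/
def flat (v : Plane) : Blowup := mk v (Projectivization.mk ℝ (dir 0 0) (dir_ne_zero 0 0))

theorem flat_congr {v v' : Plane} (h : toTorus v = toTorus v') : flat v = flat v' :=
  mk_eq_mk.2 ⟨h, fun _ => rfl⟩

theorem toTorus_eq_of_flat_eq {v v' : Plane} (h : flat v = flat v') : toTorus v = toTorus v' :=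
  (mk_eq_mk.1 h).1

theorem flat_eq_mk {v : Plane} (h : toTorus v ≠ 0) (l : ℙ ℝ Plane) : flat v = mk v l :=
  mk_eq_mk.2 ⟨rfl, fun h' => absurd h' h⟩

theorem perm_flat (A : Matrix.SpecialLinearGroup (Fin 2) ℤ) {v : Plane} (h : toTorus v ≠ 0) :
    perm A (flat v) = flat (planeMap A v) := by
  rw [flat_eq_mk (mt (toTorus_planeMap A).1 h)]
  exact lift_mk A _ _

theorem contMDiffAt_flat {v : Plane} (h : toTorus v ≠ 0) :
    ContMDiffAt 𝓘(ℝ, Plane) 𝓘(ℝ, Plane) ω flat v :=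
  contMDiffAt_param (i := .inl ⟨v, h⟩) ⟨by simp, h⟩

/-- The derivative at `v` of the projection of the plane to the blow-up. -/
def flatDeriv (v : Plane) : Plane →L[ℝ] Plane := mfderiv 𝓘(ℝ, Plane) 𝓘(ℝ, Plane) flat v

theorem mdifferentiableAt_flat {v : Plane} (h : toTorus v ≠ 0) :
    MDifferentiableAt 𝓘(ℝ, Plane) 𝓘(ℝ, Plane) flat v :=
  (contMDiffAt_flat h).mdifferentiableAt (by simp)

theorem flatDeriv_injective {v : Plane} (h : toTorus v ≠ 0) : Injective (flatDeriv v) :=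
  mfderiv_param_injective (i := .inl ⟨v, h⟩) ⟨by simp, h⟩

/-- The derivative of the projection only depends on the point of the torus. -/
theorem flatDeriv_congr {v v' : Plane} (h0 : toTorus v ≠ 0) (h : toTorus v = toTorus v') :
    flatDeriv v = flatDeriv v' := by
  have h1 : flat = flat ∘ fun y : Plane => y + (v' - v) := by
    funext y
    exact flat_congr (by rw [toTorus_add, toTorus_sub, h, sub_self, add_zero])
  have h2 : HasFDerivAt (fun y : Plane => y + (v' - v)) (ContinuousLinearMap.id ℝ Plane) v :=
    (hasFDerivAt_id v).add_const _
  have h3 : v + (v' - v) = v' := by abel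
  have h4 : HasMFDerivAt 𝓘(ℝ, Plane) 𝓘(ℝ, Plane) flat (v + (v' - v)) (flatDeriv v') := by
    rw [h3]
    exact (mdifferentiableAt_flat (h ▸ h0)).hasMFDerivAt
  have h5 := h4.comp v h2.hasMFDerivAt
  rw [← h1] at h5
  exact hasMFDerivAt_unique (mdifferentiableAt_flat h0).hasMFDerivAt h5

theorem tderiv_perm_flatDeriv (A : Matrix.SpecialLinearGroup (Fin 2) ℤ) {v : Plane}
    (h : toTorus v ≠ 0) (x : Plane) :
    Dyn.tderiv (E := Plane) (perm A) (flat v) (flatDeriv v x) =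
      flatDeriv (planeMap A v) (planeMap A x) := by
  refine Dyn.tderiv_apply_of_semiconj (Ψ := flat)
    (L := LinearMap.toContinuousLinearMap (planeMap A)) ?_ (mdifferentiable_perm A _)
    (mdifferentiableAt_flat h) (mdifferentiableAt_flat (mt (toTorus_planeMap A).1 h)) x
  filter_upwards [(isOpen_compl_singleton.preimage continuous_toTorus).mem_nhds h] with y hy
  exact perm_flat A hy

/-- The basis of the plane formed by two vectors of nonzero determinant. -/
def basisOf {b d : Plane} (h : cross b d ≠ 0) : Module.Basis (Fin 2) ℝ Plane :=
  basisOfLinearIndependentOfCardEqFinrank (b := ![b, d]) (by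
    rw [LinearIndependent.pair_iff]
    intro s t hst
    have e0 := congrFun hst 0
    have e1 := congrFun hst 1
    simp only [Pi.add_apply, Pi.smul_apply, smul_eq_mul, Pi.zero_apply] at e0 e1
    unfold cross at h
    constructor
    · have : s * (b 0 * d 1 - b 1 * d 0) = 0 := by linear_combination d 1 * e0 - d 0 * e1
      exact (mul_eq_zero.1 this).resolve_right h
    · have : t * (b 0 * d 1 - b 1 * d 0) = 0 := by linear_combination b 0 * e1 - b 1 * e0
      exact (mul_eq_zero.1 this).resolve_right h) (by simp)

theorem basisOf_apply {b d : Plane} (h : cross b d ≠ 0) (i : Fin 2) :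
    basisOf h i = (![b, d] : Fin 2 → Plane) i := by
  simp [basisOf]

/-- The image of the basis `(b, d)` under the derivative of the projection. -/
def flatBasis {b d v : Plane} (h : cross b d ≠ 0) (hv : toTorus v ≠ 0) :
    Module.Basis (Fin 2) ℝ Plane :=
  (basisOf h).map (LinearEquiv.ofInjectiveEndo (flatDeriv v : Plane →ₗ[ℝ] Plane)
    (flatDeriv_injective hv))

theorem flatBasis_apply {b d v : Plane} (h : cross b d ≠ 0) (hv : toTorus v ≠ 0) (i : Fin 2) :
    flatBasis h hv i = flatDeriv v ((![b, d] : Fin 2 → Plane) i) := by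
  rw [flatBasis, Module.Basis.map_apply, basisOf_apply]
  rfl

namespace Saddle

variable {A : Matrix.SpecialLinearGroup (Fin 2) ℤ} {lam : ℝ} {u w : Plane}

theorem pow_u (H : Saddle A lam u w) (k : ℕ) : planeMap (A ^ k) u = lam ^ k • u := by
  induction k with
  | zero => simp [planeMap_one]
  | succ k ih => rw [_root_.pow_succ, planeMap_mul, H.map_u, map_smul, ih, smul_smul,
      _root_.pow_succ']

theorem zpow_u (H : Saddle A lam u w) (n : ℤ) : planeMap (A ^ n) u = lam ^ n • u := by
  rcases n with k | k
  · simpa using H.pow_u k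
  · rw [zpow_negSucc, zpow_negSucc]
    exact planeMap_inv_of_eigen (pow_ne_zero _ H.ne_zero) (H.pow_u (k + 1))

theorem zpow_w (H : Saddle A lam u w) (n : ℤ) : planeMap (A ^ n) w = lam⁻¹ ^ n • w := by
  have h := H.symm.zpow_u (-n)
  rwa [inv_zpow', neg_neg, zpow_neg, ← inv_zpow] at h

theorem isHyperbolicPeriodicPt_flat (H : Saddle A lam u w) {v : Plane} (hv : toTorus v ≠ 0)
    (hp : flat v ∈ periodicPts (perm A)) :
    Dyn.IsHyperbolicPeriodicPt (E := Plane) (perm A) (flat v) := by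
  set m := minimalPeriod (perm A) (flat v) with hm
  have hm0 : m ≠ 0 := (minimalPeriod_pos_of_mem_periodicPts hp).ne'
  have hper : (perm A)^[m] (flat v) = flat v := iterate_minimalPeriod
  refine Dyn.isHyperbolicPeriodicPt_of_eigenbasis hp (flatBasis H.cross_ne hv)
    ![lam ^ m, lam⁻¹ ^ m] (fun i => ?_) (fun i => ?_)
  · rw [← hm, flatBasis_apply, perm_iterate, tderiv_perm_flatDeriv _ hv]
    rw [perm_iterate, perm_flat _ hv] at hper
    rw [flatDeriv_congr (mt (toTorus_planeMap _).1 hv) (toTorus_eq_of_flat_eq hper), ← map_smul]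
    congr 1
    fin_cases i
    · exact H.pow_u m
    · simpa using H.zpow_w m
  · fin_cases i
    · change |lam ^ m| ≠ 1
      rw [abs_of_pos (pow_pos H.pos m)]
      exact (one_lt_pow₀ H.one_lt hm0).ne'
    · change |lam⁻¹ ^ m| ≠ 1
      rw [abs_of_pos (pow_pos (inv_pos.2 H.pos) m)]
      exact (pow_lt_one₀ (inv_nonneg.2 H.pos.le) H.inv_lt_one hm0).ne

theorem hasLyapunovExponents_flat (H : Saddle A lam u w) {v : Plane} (hv : toTorus v ≠ 0)
    (hp : flat v ∈ periodicPts (perm A)) :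
    Dyn.HasLyapunovExponents (E := Plane) (perm A) (flat v) ![-Real.log lam, Real.log lam] := by
  obtain ⟨N, hN, hper⟩ := hp
  have hper' : toTorus (planeMap (A ^ N) v) = toTorus v := by
    have h1 : (perm A)^[N] (flat v) = flat v := hper
    rw [perm_iterate, perm_flat _ hv] at h1
    exact toTorus_eq_of_flat_eq h1
  have hlog : 0 < Real.log lam := Real.log_pos H.one_lt
  refine Dyn.hasLyapunovExponents_of_basis ?_ (flatBasis (cross_swap H.cross_ne) hv)
    (fun i n => flatDeriv (planeMap (A ^ n) v) ((![w, u] : Fin 2 → Plane) i)) ?_ ?_ ?_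
  · rw [Fin.strictMono_iff_lt_succ]
    intro i
    fin_cases i
    simp
    linarith
  · intro i n
    rw [Ne, map_eq_zero_iff _ (flatDeriv_injective (mt (toTorus_planeMap _).1 hv)),
      ← basisOf_apply (cross_swap H.cross_ne)]
    exact (basisOf (cross_swap H.cross_ne)).ne_zero i
  · intro i
    -- the derivative is periodic along the orbit
    have hperiodic : Function.Periodic
        (fun n : ℤ => flatDeriv (planeMap (A ^ n) v) ((![w, u] : Fin 2 → Plane) i)) (N : ℤ) := by
      intro n
      simp only
      rw [flatDeriv_congr (mt (toTorus_planeMap _).1 hv)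
        (show toTorus (planeMap (A ^ (n + (N : ℤ))) v) = toTorus (planeMap (A ^ n) v) from ?_)]
      rw [zpow_add, planeMap_mul]
      exact toTorus_planeMap_congr _ (by simpa using hper')
    rw [← hperiodic.image_Ioc (by exact_mod_cast hN) 0]
    exact (Set.finite_Ioc _ _).image _
  · intro i n
    rw [flatBasis_apply, perm_zpow]
    refine (tderiv_perm_flatDeriv (A ^ n) hv _).trans ?_
    rw [← map_smul]
    congr 1
    fin_cases i
    · change planeMap (A ^ n) w = Real.exp (n * -Real.log lam) • w
      rw [H.zpow_w, mul_neg, ← neg_mul, ← Int.cast_neg, mul_comm, Real.exp_mul,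
        Real.exp_log H.pos, Real.rpow_intCast, inv_zpow, zpow_neg]
    · change planeMap (A ^ n) u = Real.exp (n * Real.log lam) • u
      rw [H.zpow_u, mul_comm, Real.exp_mul, Real.exp_log H.pos, Real.rpow_intCast]

end Saddle

end Blowup

/-! ### Averages along orbits -/

/-- Cesàro averages of triangular arrays which are small away from both ends of the rows. -/
theorem tendsto_average_of_small_middle {g : ℕ → ℕ → ℝ} {B : ℝ} (hB : ∀ M k, |g M k| ≤ B)
    (hg : ∀ ε > 0, ∃ K, ∀ M k, K ≤ k → k + K ≤ M → |g M k| ≤ ε) :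
    Tendsto (fun M : ℕ => (M : ℝ)⁻¹ * ∑ k ∈ Finset.range M, g M k) atTop (𝓝 0) := by
  have hB0 : 0 ≤ B := (abs_nonneg _).trans (hB 0 0)
  rw [Metric.tendsto_atTop]
  intro ε hε
  obtain ⟨K, hK⟩ := hg (ε / 2) (by linarith)
  have hsum : ∀ M, |∑ k ∈ Finset.range M, g M k| ≤ M * (ε / 2) + 2 * K * B := by
    intro M
    have hpt : ∀ k ∈ Finset.range M, |g M k| ≤
        ε / 2 + ((if k < K then B else 0) + (if M < k + K then B else 0)) := by
      intro k _
      have h1 := hB M k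
      split_ifs with h2 h3 h3
      · linarith
      · linarith
      · linarith
      · linarith [hK M k (by omega) (by omega)]
    refine (Finset.abs_sum_le_sum_abs _ _).trans ((Finset.sum_le_sum hpt).trans ?_)
    rw [Finset.sum_add_distrib, Finset.sum_add_distrib, ← Finset.sum_filter, ← Finset.sum_filter,
      Finset.sum_const, Finset.sum_const, Finset.sum_const, Finset.card_range]
    simp only [nsmul_eq_mul]
    have c1 : (({k ∈ Finset.range M | k < K} : Finset ℕ).card : ℝ) ≤ K := by
      have : ({k ∈ Finset.range M | k < K} : Finset ℕ) ⊆ Finset.range K := by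
        intro k hk; simp at hk ⊢; exact hk.2
      exact_mod_cast (Finset.card_le_card this).trans (by simp)
    have c2 : (({k ∈ Finset.range M | M < k + K} : Finset ℕ).card : ℝ) ≤ K := by
      have : ({k ∈ Finset.range M | M < k + K} : Finset ℕ) ⊆ Finset.Ico (M - K) M := by
        intro k hk; simp at hk ⊢; omega
      have h2 := Finset.card_le_card this
      rw [Nat.card_Ico] at h2
      exact_mod_cast h2.trans (by omega)
    nlinarith
  obtain ⟨M₀, hM₀⟩ := exists_nat_gt (2 * K * B / (ε / 2))
  refine ⟨max M₀ 1, fun M hM => ?_⟩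
  have hM1 : (0 : ℝ) < M := by exact_mod_cast (le_max_right _ _).trans hM
  have hM2 : (M₀ : ℝ) ≤ M := by exact_mod_cast (le_max_left _ _).trans hM
  rw [dist_zero_right, Real.norm_eq_abs, abs_mul, abs_of_pos (inv_pos.2 hM1), inv_mul_lt_iff₀ hM1]
  rw [div_lt_iff₀ (by linarith)] at hM₀
  have := hsum M
  nlinarith

/-- Birkhoff averages of a periodic point over a full period do not depend on the period. -/
theorem average_minimalPeriod {X : Type*} {f : X → X} {x : X} {n : ℕ} (hn : 0 < n)
    (h : IsPeriodicPt f n x) (φ : X → ℝ) :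
    (minimalPeriod f x : ℝ)⁻¹ * ∑ k ∈ Finset.range (minimalPeriod f x), φ (f^[k] x) =
      (n : ℝ)⁻¹ * ∑ k ∈ Finset.range n, φ (f^[k] x) := by
  set m := minimalPeriod f x with hm
  obtain ⟨q, rfl⟩ : m ∣ n := h.minimalPeriod_dvd
  have hm0 : (m : ℝ) ≠ 0 := by
    intro h0
    rw [Nat.cast_eq_zero] at h0
    simp [h0] at hn
  have hq0 : (q : ℝ) ≠ 0 := by
    intro h0
    rw [Nat.cast_eq_zero] at h0
    simp [h0] at hn
  have hsum : ∀ q : ℕ, ∑ k ∈ Finset.range (m * q), φ (f^[k] x) =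
      q * ∑ k ∈ Finset.range m, φ (f^[k] x) := by
    intro q
    induction q with
    | zero => simp
    | succ q ih =>
      rw [Nat.mul_succ, Finset.sum_range_add, ih]
      have : ∀ k, f^[m * q + k] x = f^[k] x := by
        intro k
        rw [add_comm, iterate_add_apply]
        exact congrArg _ ((isPeriodicPt_minimalPeriod f x).mul_const q)
      simp only [this]
      push_cast
      ring
  rw [hsum]
  push_cast
  field_simp

namespace Dyn

theorem isProbabilityMeasure_orbitMeasure {X : Type*} [MeasurableSpace X] {f : X → X} {x : X}
    (hx : x ∈ periodicPts f) : IsProbabilityMeasure (orbitMeasure f x) := by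
  constructor
  have h0 : (minimalPeriod f x : ℝ≥0∞) ≠ 0 := by
    exact_mod_cast (minimalPeriod_pos_of_mem_periodicPts hx).ne'
  simp [orbitMeasure, ENNReal.inv_mul_cancel h0]

theorem integral_orbitMeasure {X : Type*} [MeasurableSpace X] [TopologicalSpace X] [T1Space X]
    [BorelSpace X] (f : X → X) (x : X) (φ : BoundedContinuousFunction X ℝ) :
    ∫ y, φ y ∂(orbitMeasure f x) =
      (minimalPeriod f x : ℝ)⁻¹ * ∑ k ∈ Finset.range (minimalPeriod f x), φ (f^[k] x) := by
  rw [orbitMeasure, integral_smul_measure, integral_finsetSum_measure]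
  · simp
  · intro k _
    exact φ.integrable _

end Dyn

/-! ### Periodic orbits shadowing a homoclinic loop -/

namespace Blowup

/-- The points `(a u + b w) / (lam ^ M - lam ^ (-M))` of the plane.  Their images under `A ^ M` and
`A ^ (-M)` differ by `a u - b w`, so that they project to periodic points of the torus if this
vector is integral. -/
def centerPoint (lam : ℝ) (u w : Plane) (a b : ℝ) (M : ℕ) : Plane :=
  (lam ^ M - lam⁻¹ ^ M)⁻¹ • (a • u + b • w)

theorem centerPoint_swap (lam : ℝ) (u w : Plane) (a b : ℝ) :
    centerPoint lam u w a b = centerPoint lam w u b a := by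
  funext M
  rw [centerPoint, centerPoint, add_comm]

namespace Saddle

variable {A : Matrix.SpecialLinearGroup (Fin 2) ℤ} {lam : ℝ} {u w : Plane}

theorem pow_sub_inv_pow_ge (H : Saddle A lam u w) {M : ℕ} (hM : M ≠ 0) :
    (1 - lam⁻¹) * lam ^ M ≤ lam ^ M - lam⁻¹ ^ M := by
  have h1 : lam⁻¹ ^ M ≤ lam⁻¹ := pow_le_of_le_one (inv_nonneg.2 H.pos.le) H.inv_lt_one.le hM
  have h2 : 1 ≤ lam ^ M := one_le_pow₀ H.one_lt.le
  have h3 : 0 < lam⁻¹ := inv_pos.2 H.pos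
  nlinarith

theorem pow_sub_inv_pow_pos (H : Saddle A lam u w) {M : ℕ} (hM : M ≠ 0) :
    0 < lam ^ M - lam⁻¹ ^ M :=
  (mul_pos (sub_pos.2 H.inv_lt_one) (pow_pos H.pos M)).trans_le (H.pow_sub_inv_pow_ge hM)

theorem planeMap_pow_centerPoint (H : Saddle A lam u w) (a b : ℝ) (M k : ℕ) :
    planeMap (A ^ k) (centerPoint lam u w a b M) =
      (lam ^ M - lam⁻¹ ^ M)⁻¹ • ((a * lam ^ k) • u + (b * lam⁻¹ ^ k) • w) := by
  have hw : planeMap (A ^ k) w = lam⁻¹ ^ k • w := by simpa using H.zpow_w k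
  rw [centerPoint, map_smul, map_add, map_smul, map_smul, H.pow_u, hw, smul_smul, smul_smul]

/-- The forward half of the orbit of a center point in the eigencoordinates. -/
theorem iterate_flat_centerPoint (H : Saddle A lam u w) {a : ℝ} (ha : a ≠ 0) (b : ℝ) {M : ℕ}
    (hM : toTorus (centerPoint lam u w a b M) ≠ 0) (k : ℕ) :
    (perm A)^[k] (flat (centerPoint lam u w a b M)) =
      polar u w ![(lam ^ M - lam⁻¹ ^ M)⁻¹ * (a * lam ^ k), b / a * (lam⁻¹ / lam) ^ k] := by
  rw [perm_iterate, perm_flat _ hM]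
  have hk : a * lam ^ k ≠ 0 := mul_ne_zero ha (pow_ne_zero _ H.ne_zero)
  have h1 : (a * lam ^ k) • u + (b * lam⁻¹ ^ k) • w =
      (a * lam ^ k) • (u + (b / a * (lam⁻¹ / lam) ^ k) • w) := by
    rw [smul_add, smul_smul]
    congr 2
    have := pow_ne_zero k H.ne_zero
    rw [div_pow]
    field_simp
  rw [flat_eq_mk (mt (toTorus_planeMap _).1 hM), polar, H.planeMap_pow_centerPoint, h1, smul_smul]
  rfl

/-- In the forward half of its orbit, the center point spends most of its time near the line of
`u`. -/
theorem tendsto_average_half_orbit (H : Saddle A lam u w) {a b : ℝ} (ha : a ≠ 0)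
    {M₀ : ℕ} (h0 : ∀ M, M₀ ≤ M → toTorus (centerPoint lam u w a b M) ≠ 0)
    (φ : BoundedContinuousFunction Blowup ℝ) :
    Tendsto (fun M : ℕ => (M : ℝ)⁻¹ *
      ∑ k ∈ Finset.range M, φ ((perm A)^[k] (flat (centerPoint lam u w a b M)))) atTop
      (𝓝 (φ (polar u w 0))) := by
  have key : Tendsto (fun M : ℕ => (M : ℝ)⁻¹ * ∑ k ∈ Finset.range M,
      (φ ((perm A)^[k] (flat (centerPoint lam u w a b M))) - φ (polar u w 0))) atTop (𝓝 0) := by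
    refine tendsto_average_of_small_middle (B := 2 * ‖φ‖) (fun M k => ?_) (fun ε hε => ?_)
    · exact φ.dist_le_two_norm _ _
    · have hcont : ContinuousAt (φ ∘ polar u w) 0 :=
        φ.continuous.continuousAt.comp (contMDiffAt_polar H.cross_ne rfl).continuousAt
      obtain ⟨δ, hδ, hφ⟩ := Metric.continuousAt_iff.1 hcont ε hε
      have hlim : ∀ C : ℝ, ∀ᶠ K : ℕ in atTop, lam⁻¹ ^ K * C < δ := fun C =>
        (tendsto_pow_mul_of_lt_one (inv_nonneg.2 H.pos.le) H.inv_lt_one C).eventually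
          (gt_mem_nhds hδ)
      obtain ⟨K, hK1, hK2, hK3, hK4⟩ := ((hlim (|a| / (1 - lam⁻¹))).and
        ((hlim |b / a|).and ((eventually_ge_atTop M₀).and (eventually_ge_atTop 1)))).exists
      refine ⟨K, fun M k hk hkM => ?_⟩
      rw [H.iterate_flat_centerPoint ha b (h0 M (by omega))]
      -- both eigencoordinates are bounded by a constant times `lam ^ (-K)`
      refine (hφ (x := ![_, _]) ?_).le
      have hM : M ≠ 0 := by omega
      have hinv := inv_pos.2 H.pos
      have hd := H.pow_sub_inv_pow_pos hM
      have h1l : 0 < 1 - lam⁻¹ := sub_pos.2 H.inv_lt_one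
      have hanti : ∀ {i : ℕ}, K ≤ i → lam⁻¹ ^ i ≤ lam⁻¹ ^ K := fun h =>
        pow_le_pow_of_le_one hinv.le H.inv_lt_one.le h
      rw [dist_zero_right, pi_norm_lt_iff hδ, Fin.forall_fin_two]
      constructor
      · refine lt_of_le_of_lt ?_ hK1
        have e1 : lam ^ k = lam ^ M * lam⁻¹ ^ (M - k) := by
          rw [← Nat.add_sub_of_le (show k ≤ M by omega), Nat.add_sub_cancel_left, pow_add,
            inv_pow, mul_assoc, mul_inv_cancel₀ (pow_ne_zero _ H.ne_zero), mul_one]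
        simp only [Matrix.cons_val_zero, Real.norm_eq_abs]
        rw [abs_mul, abs_mul, abs_of_pos (inv_pos.2 hd), abs_of_pos (pow_pos H.pos k),
          inv_mul_le_iff₀ hd, e1]
        have e2 : lam⁻¹ ^ (M - k) ≤ lam⁻¹ ^ K := hanti (by omega)
        calc |a| * (lam ^ M * lam⁻¹ ^ (M - k)) ≤ |a| * (lam ^ M * lam⁻¹ ^ K) := by
              have := pow_pos H.pos M
              gcongr
          _ = ((1 - lam⁻¹) * lam ^ M) * (lam⁻¹ ^ K * (|a| / (1 - lam⁻¹))) := by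
              linear_combination (-(lam ^ M * lam⁻¹ ^ K)) * div_mul_cancel₀ |a| h1l.ne'
          _ ≤ _ := by
              refine mul_le_mul_of_nonneg_right (H.pow_sub_inv_pow_ge hM) ?_
              have := pow_pos hinv K
              positivity
      · refine lt_of_le_of_lt ?_ hK2
        simp only [Matrix.cons_val_one, Matrix.cons_val_fin_one, Real.norm_eq_abs]
        rw [abs_mul, abs_of_nonneg (pow_nonneg H.ratio_pos k), mul_comm]
        refine mul_le_mul_of_nonneg_right ?_ (abs_nonneg _)
        refine (pow_le_pow_left₀ H.ratio_pos ?_ k).trans (hanti hk)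
        exact div_le_self hinv.le H.one_lt.le
  have h2 := key.add_const (φ (polar u w 0))
  rw [zero_add] at h2
  refine h2.congr' ?_
  filter_upwards [eventually_gt_atTop 0] with M hM
  have hM' : (M : ℝ) ≠ 0 := by exact_mod_cast hM.ne'
  rw [Finset.sum_sub_distrib, Finset.sum_const, Finset.card_range, nsmul_eq_mul, mul_sub,
    inv_mul_cancel_left₀ hM']
  ring

/-- For large `M` the center point is nonzero and close to the origin, so not a lattice point. -/
theorem eventually_toTorus_centerPoint_ne_zero (H : Saddle A lam u w) {a : ℝ} (ha : a ≠ 0) (b : ℝ) :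
    ∃ M₀ : ℕ, M₀ ≠ 0 ∧ ∀ M, M₀ ≤ M → toTorus (centerPoint lam u w a b M) ≠ 0 := by
  have h1 : Tendsto (fun M : ℕ => (lam ^ M - lam⁻¹ ^ M)⁻¹) atTop (𝓝 0) := by
    refine Tendsto.inv_tendsto_atTop ?_
    refine tendsto_atTop_mono' (f₁ := fun M : ℕ => (1 - lam⁻¹) * lam ^ M) _ ?_
      ((tendsto_pow_atTop_atTop_of_one_lt H.one_lt).const_mul_atTop (sub_pos.2 H.inv_lt_one))
    filter_upwards [eventually_ne_atTop 0] with M hM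
    exact H.pow_sub_inv_pow_ge hM
  have h2 : Tendsto (centerPoint lam u w a b) atTop (𝓝 0) := by
    have h3 := h1.smul_const (a • u + b • w)
    rwa [zero_smul] at h3
  obtain ⟨M₀, hM₀⟩ := eventually_atTop.1
    ((h2.eventually (Metric.ball_mem_nhds (0 : Plane) (ε := 1 / 2) (by norm_num))).and
      (eventually_ne_atTop 0))
  refine ⟨M₀, (hM₀ M₀ le_rfl).2, fun M hM h => ?_⟩
  obtain ⟨h3, h4⟩ := hM₀ M hM
  have h3' : centerPoint lam u w a b M ∈ Metric.ball (0 : Plane) (1 / 2) := h3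
  rw [mem_ball_zero_iff] at h3'
  have h5 : centerPoint lam u w a b M = 0 :=
    toTorus_inj_box (h.trans toTorus_zero.symm) (fun i => (norm_le_pi_norm _ i).trans_lt h3')
      (by simp)
  have h6 : cross (centerPoint lam u w a b M) w = (lam ^ M - lam⁻¹ ^ M)⁻¹ * (a * cross u w) := by
    simp only [centerPoint, cross, Pi.add_apply, Pi.smul_apply, smul_eq_mul]
    ring
  rw [h5] at h6
  have h7 : cross 0 w = 0 := by simp [cross]
  rw [h7] at h6
  exact mul_ne_zero (_root_.inv_ne_zero (H.pow_sub_inv_pow_pos h4).ne')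
    (mul_ne_zero ha H.cross_ne) h6.symm

/-- The first basis vector is not on the line of `w`, as `lam⁻¹` would then be an integral entry of
`A` in the interval `(0, 1)`. -/
theorem ne_smul_w (H : Saddle A lam u w) (b : ℝ) : (![1, 0] : Plane) ≠ b • w := by
  intro h
  have h1 : planeMap A ![1, 0] = lam⁻¹ • ![1, 0] := by
    rw [h, map_smul, H.map_w, smul_comm]
  have h2 := congrFun h1 0
  rw [planeMap_apply_zero] at h2
  simp only [Matrix.cons_val_zero, Matrix.cons_val_one, mul_one, mul_zero, add_zero,
    Pi.smul_apply, smul_eq_mul, Matrix.cons_val_fin_one] at h2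
  have h3 : (0 : ℝ) < A.1 0 0 := by rw [h2]; exact inv_pos.2 H.pos
  have h4 : (A.1 0 0 : ℝ) < 1 := by rw [h2]; exact H.inv_lt_one
  have h5 : 0 < A.1 0 0 := by exact_mod_cast h3
  have h6 : A.1 0 0 < 1 := by exact_mod_cast h4
  omega

/-- If `a u - b w` is integral, then the two ends `A ^ M y` and `A ^ (-M) y` of the orbit segment of
`y = centerPoint lam u w a b M` agree in the torus. -/
theorem isPeriodicPt_centerPoint (H : Saddle A lam u w) {a b : ℝ}
    (hab : toTorus (a • u - b • w) = 0) {M : ℕ} (hM0 : M ≠ 0)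
    (hM : toTorus (centerPoint lam u w a b M) ≠ 0) :
    IsPeriodicPt (perm A) (M + M) (flat (centerPoint lam u w a b M)) := by
  set y := centerPoint lam u w a b M with hy
  have hd : lam ^ M - lam⁻¹ ^ M ≠ 0 := (H.pow_sub_inv_pow_pos hM0).ne'
  have h1 : planeMap (A ^ M) y = planeMap (A⁻¹ ^ M) y + (a • u - b • w) := by
    have e1 := H.planeMap_pow_centerPoint a b M M
    have e2 := H.symm.planeMap_pow_centerPoint b a M M
    rw [← centerPoint_swap] at e2
    rw [hy, e1, e2]
    ext i
    simp only [Pi.add_apply, Pi.sub_apply, Pi.smul_apply, smul_eq_mul]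
    linear_combination (a * u i - b * w i) * inv_mul_cancel₀ hd
  have h2 : toTorus (planeMap (A ^ M) y) = toTorus (planeMap (A⁻¹ ^ M) y) := by
    rw [h1, toTorus_add, hab, add_zero]
  change (perm A)^[M + M] (flat y) = flat y
  rw [perm_iterate, perm_flat _ hM]
  refine flat_congr ?_
  rw [pow_add, planeMap_mul, toTorus_planeMap_congr _ h2, ← planeMap_mul, inv_pow, mul_inv_cancel,
    planeMap_one]

/-- The Birkhoff averages over the orbits of the center points: the backward halves of the orbits
spend most of their time near the line of `w`. -/
theorem tendsto_average_orbit (H : Saddle A lam u w) {a b : ℝ} (ha : a ≠ 0) (hb : b ≠ 0)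
    (hab : toTorus (a • u - b • w) = 0) {M₀ : ℕ} (hM₀ : M₀ ≠ 0)
    (h0 : ∀ M, M₀ ≤ M → toTorus (centerPoint lam u w a b M) ≠ 0)
    (φ : BoundedContinuousFunction Blowup ℝ) :
    Tendsto (fun M : ℕ => ((M + M : ℕ) : ℝ)⁻¹ *
      ∑ k ∈ Finset.range (M + M), φ ((perm A)^[k] (flat (centerPoint lam u w a b M)))) atTop
      (𝓝 (2⁻¹ * φ (polar u w 0) + 2⁻¹ * φ (polar w u 0))) := by
  have h1 := H.tendsto_average_half_orbit ha h0 φ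
  have h2 := H.symm.tendsto_average_half_orbit (a := b) (b := a) hb (M₀ := M₀)
    (by rw [← centerPoint_swap]; exact h0)
    (φ.compContinuous ⟨perm A⁻¹, (contMDiff_perm A⁻¹).continuous⟩)
  rw [← centerPoint_swap] at h2
  simp only [BoundedContinuousFunction.compContinuous_apply, ContinuousMap.coe_mk, H.symm.perm_u]
    at h2
  refine ((h1.const_mul 2⁻¹).add (h2.const_mul 2⁻¹)).congr' ?_
  filter_upwards [eventually_ge_atTop M₀] with M hM
  have hM1 : M ≠ 0 := by omega
  set x := flat (centerPoint lam u w a b M) with hx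
  have hper : (perm A)^[M + M] x = x := H.isPeriodicPt_centerPoint hab hM1 (h0 M hM)
  -- the second half of the orbit is the reversed backward orbit
  have hback : ∀ k, k < M → (perm A)^[M + (M - 1 - k)] x = perm A⁻¹ ((perm A⁻¹)^[k] x) := by
    intro k hk
    have e1 : M + M = (k + 1) + (M + (M - 1 - k)) := by omega
    rw [← iterate_succ_apply' (perm A⁻¹)]
    conv_rhs => rw [← hper, e1, iterate_add_apply (perm A)]
    have e2 : LeftInverse (perm A⁻¹) (perm A) := (perm A).left_inv
    exact ((e2.iterate (k + 1)) _).symm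
  have hsum : ∑ k ∈ Finset.range M, φ (perm A⁻¹ ((perm A⁻¹)^[k] x)) =
      ∑ k ∈ Finset.range M, φ ((perm A)^[M + k] x) := by
    rw [← Finset.sum_range_reflect (fun k => φ ((perm A)^[M + k] x))]
    refine Finset.sum_congr rfl fun k hk => ?_
    rw [hback k (Finset.mem_range.1 hk)]
  rw [hsum, Finset.sum_range_add]
  push_cast
  have hM2 : (M : ℝ) ≠ 0 := by exact_mod_cast hM1
  field_simp
  ring

theorem iterate_flat_notMem_exceptionalFiber (A : Matrix.SpecialLinearGroup (Fin 2) ℤ) {v : Plane}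
    (hv : toTorus v ≠ 0) (k : ℕ) : (perm A)^[k] (flat v) ∉ exceptionalFiber := by
  rw [perm_iterate, perm_flat _ hv]
  intro h
  have h1 : proj (flat (planeMap (A ^ k) v)) = 0 := h
  rw [flat, proj_mk, toTorus_planeMap] at h1
  exact hv h1

theorem exists_periodic_orbits (H : Saddle A lam u w) :
    ∃ (x : ℕ → Blowup) (ν : ℕ → ProbabilityMeasure Blowup),
      (∀ n, Dyn.IsHyperbolicPeriodicPt (E := Plane) (perm A) (x n)) ∧
      (∀ n k, (perm A)^[k] (x n) ∉ exceptionalFiber) ∧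
      (∀ n k, Dyn.HasLyapunovExponents (E := Plane) (perm A) ((perm A)^[k] (x n))
        ![-Real.log lam, Real.log lam]) ∧
      (∀ n, (ν n : Measure Blowup) = Dyn.orbitMeasure (perm A) (x n)) ∧
      Tendsto ν atTop (𝓝 (halfDirac (polar u w 0) (polar w u 0))) := by
  -- an integral vector, with nonzero components along both eigenlines
  obtain ⟨a, b, hz⟩ : ∃ a b : ℝ, (![1, 0] : Plane) = a • u - b • w :=
    ⟨cross ![1, 0] w / cross u w, -(cross u ![1, 0] / cross u w), by
      rw [neg_smul, sub_neg_eq_add]; exact eq_smul_add_smul H.cross_ne _⟩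
  have ha : a ≠ 0 := by
    rintro rfl
    rw [zero_smul, zero_sub, ← neg_smul] at hz
    exact H.ne_smul_w _ hz
  have hb : b ≠ 0 := by
    rintro rfl
    rw [zero_smul, sub_zero] at hz
    exact H.symm.ne_smul_w _ hz
  have hab : toTorus (a • u - b • w) = 0 := by
    rw [← hz]
    ext i
    fin_cases i
    · exact (AddCircle.coe_eq_zero_iff (1 : ℝ)).2 ⟨1, by simp⟩
    · exact (AddCircle.coe_eq_zero_iff (1 : ℝ)).2 ⟨0, by simp⟩
  obtain ⟨M₀, hM₀, h0⟩ := H.eventually_toTorus_centerPoint_ne_zero ha b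
  have hne : ∀ n, toTorus (centerPoint lam u w a b (n + M₀)) ≠ 0 := fun n => h0 _ (by omega)
  have hper : ∀ n, IsPeriodicPt (perm A) ((n + M₀) + (n + M₀))
      (flat (centerPoint lam u w a b (n + M₀))) := fun n =>
    H.isPeriodicPt_centerPoint hab (by omega) (hne n)
  have hmem : ∀ n, flat (centerPoint lam u w a b (n + M₀)) ∈ periodicPts (perm A) := fun n =>
    mk_mem_periodicPts (by omega) (hper n)
  let ν : ℕ → ProbabilityMeasure Blowup := fun n =>
    ⟨_, Dyn.isProbabilityMeasure_orbitMeasure (hmem n)⟩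
  refine ⟨fun n => flat (centerPoint lam u w a b (n + M₀)), ν,
    fun n => H.isHyperbolicPeriodicPt_flat (hne n) (hmem n),
    fun n k => iterate_flat_notMem_exceptionalFiber A (hne n) k, fun n k => ?_, fun n => rfl, ?_⟩
  · have h1 := Dyn.iterate_mem_periodicPts (hmem n) k
    simp only [perm_iterate A k, perm_flat _ (hne n)] at h1 ⊢
    exact H.hasLyapunovExponents_flat (mt (toTorus_planeMap _).1 (hne n)) h1
  · refine ProbabilityMeasure.tendsto_iff_forall_integral_tendsto.2 fun φ => ?_
    have h1 := (H.tendsto_average_orbit ha hb hab hM₀ h0 φ).comp (tendsto_add_atTop_nat M₀)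
    have h2 : ∫ y, φ y ∂(halfDirac (polar u w 0) (polar w u 0) : Measure Blowup) =
        2⁻¹ * φ (polar u w 0) + 2⁻¹ * φ (polar w u 0) := by
      change ∫ y, φ y ∂((2⁻¹ : ℝ≥0∞) • Measure.dirac (polar u w 0) +
        (2⁻¹ : ℝ≥0∞) • Measure.dirac (polar w u 0)) = _
      rw [integral_add_measure ((φ.integrable _).smul_measure (by simp))
        ((φ.integrable _).smul_measure (by simp)), integral_smul_measure, integral_smul_measure]
      simp
    rw [h2]
    refine h1.congr fun n => ?_
    refine Eq.trans ?_ (Dyn.integral_orbitMeasure _ _ φ).symm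
    exact (average_minimalPeriod (by omega) (hper n) φ).symm

end Saddle

end Blowup

namespace Blowup

theorem cross_ne_zero_of_eigen {A : Matrix.SpecialLinearGroup (Fin 2) ℤ} {lam : ℝ} (hlam : 1 < lam)
    {u w : Plane} (hu : u ≠ 0) (hw : w ≠ 0) (hAu : planeMap A u = lam • u)
    (hAw : planeMap A w = lam⁻¹ • w) : cross u w ≠ 0 := by
  intro h
  have hdir : ∃ j : Fin 2, u j ≠ 0 := by
    by_contra! h0
    exact hu (funext h0)
  obtain ⟨j, hj⟩ := hdir
  have hwu : u j • w = w j • u := by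
    refine plane_ext j ?_ ?_
    · simp [mul_comm]
    · simp only [Pi.smul_apply, smul_eq_mul]
      unfold cross at h
      fin_cases j <;> simp <;> linarith
  have h1 := congrArg (planeMap A) hwu
  rw [map_smul, map_smul, hAu, hAw, smul_comm, smul_comm (w j), ← hwu] at h1
  have h2 : lam⁻¹ ≠ lam := ((inv_lt_one_of_one_lt₀ hlam).trans hlam).ne
  have h3 : (lam⁻¹ - lam) • u j • w = 0 := by rw [sub_smul, h1, sub_self]
  exact smul_ne_zero (sub_ne_zero.2 h2) (smul_ne_zero hj hw) h3

end Blowup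

end

theorem mainTheorem9 (A : Matrix.SpecialLinearGroup (Fin 2) ℤ) (lam : ℝ) (hlam : 1 < lam)
    (u w : Plane) (hu : u ≠ 0) (hw : w ≠ 0)
    (hAu : planeMap A u = lam • u) (hAw : planeMap A w = lam⁻¹ • w)
    (f : Equiv.Perm Blowup) (hf : f = Blowup.perm A)
    (p₁ p₂ : Blowup)
    (hp₁ : p₁ = Blowup.exceptional (Projectivization.mk ℝ u hu))
    (hp₂ : p₂ = Blowup.exceptional (Projectivization.mk ℝ w hw)) :
    -- `f` is an analytic diffeomorphism
    ContMDiff 𝓘(ℝ, Plane) 𝓘(ℝ, Plane) ω f ∧ ContMDiff 𝓘(ℝ, Plane) 𝓘(ℝ, Plane) ω f.symm ∧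
    -- `p₁` and `p₂` are hyperbolic fixed saddles, both of stable index one
    f p₁ = p₁ ∧ f p₂ = p₂ ∧
    Dyn.IsHyperbolicPeriodicPt (E := Plane) f p₁ ∧ Dyn.IsHyperbolicPeriodicPt (E := Plane) f p₂ ∧
    Dyn.stableIndex (E := Plane) f p₁ = 1 ∧ Dyn.stableIndex (E := Plane) f p₂ = 1 ∧
    -- their intersection classes are trivial and disjoint
    Dyn.intersectionClass (E := Plane) f p₁ = {p₁} ∧
    Dyn.intersectionClass (E := Plane) f p₂ = {p₂} ∧
    Disjoint (Dyn.intersectionClass (E := Plane) f p₁) (Dyn.intersectionClass (E := Plane) f p₂) ∧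
    -- their homoclinic classes are trivial and disjoint
    Dyn.homoclinicClass (E := Plane) f p₁ = {p₁} ∧
    Dyn.homoclinicClass (E := Plane) f p₂ = {p₂} ∧
    closure (Dyn.transverseIntersection (E := Plane) f p₁ p₁) = {p₁} ∧
    closure (Dyn.transverseIntersection (E := Plane) f p₂ p₂) = {p₂} ∧
    Disjoint (Dyn.homoclinicClass (E := Plane) f p₁) (Dyn.homoclinicClass (E := Plane) f p₂) ∧
    -- in particular they are not homoclinically related
    ¬ Dyn.HomoclinicallyRelated (E := Plane) f p₁ p₂ ∧
    -- nevertheless `½ δ_{p₁} + ½ δ_{p₂}` is a limit of hyperbolic periodic orbits off the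
    -- exceptional fibre, with exponents `± log lam`
    ∃ (x : ℕ → Blowup) (ν : ℕ → ProbabilityMeasure Blowup),
      (∀ n, Dyn.IsHyperbolicPeriodicPt (E := Plane) f (x n)) ∧
      (∀ n k, f^[k] (x n) ∉ Blowup.exceptionalFiber) ∧
      (∀ n k, Dyn.HasLyapunovExponents (E := Plane) f (f^[k] (x n))
        ![-Real.log lam, Real.log lam]) ∧
      (∀ n, (ν n : Measure Blowup) = Dyn.orbitMeasure f (x n)) ∧
      Tendsto ν atTop (𝓝 (Blowup.halfDirac p₁ p₂)) := by
  subst hf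
  have H : Blowup.Saddle A lam u w :=
    ⟨hlam, Blowup.cross_ne_zero_of_eigen hlam hu hw hAu hAw, hAu, hAw⟩
  have e₁ : p₁ = Blowup.polar u w 0 := by
    rw [hp₁, Blowup.polar_zero, Blowup.line_of_ne_zero hu]
  have e₂ : p₂ = Blowup.polar w u 0 := by
    rw [hp₂, Blowup.polar_zero, Blowup.line_of_ne_zero hw]
  rw [e₁, e₂]
  have hd : Disjoint ({Blowup.polar u w 0} : Set Blowup) {Blowup.polar w u 0} :=
    disjoint_singleton.2 H.polar_ne
  refine ⟨Blowup.contMDiff_perm A, ?_, H.perm_u, H.perm_w, H.isHyperbolicPeriodicPt_u,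
    H.isHyperbolicPeriodicPt_w, H.stableIndex_u, H.stableIndex_w, H.intersectionClass_u,
    H.intersectionClass_w, ?_, ?_, ?_, ?_, ?_, ?_, H.not_homoclinicallyRelated,
    H.exists_periodic_orbits⟩
  · rw [Blowup.perm_symm]
    exact Blowup.contMDiff_perm A⁻¹
  · rwa [H.intersectionClass_u, H.intersectionClass_w]
  · rw [Dyn.homoclinicClass, H.intersectionClass_u, closure_singleton]
  · rw [Dyn.homoclinicClass, H.intersectionClass_w, closure_singleton]
  · rw [H.transverseIntersection_u, closure_singleton]
  · rw [H.transverseIntersection_w, closure_singleton]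
  · rwa [Dyn.homoclinicClass, Dyn.homoclinicClass, H.intersectionClass_u, H.intersectionClass_w,
      closure_singleton, closure_singleton]
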